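/- Notation. For a real $n\times p$ matrix $X$ with columns $x_1,\dots,x_p$ and a linear subspace ${\cal V}\subset\mathbb R^n$ let $\delta({\cal V},X):=\max_{1\le j\le p}\|x_j^{{\cal V}^\perp}\|_2$, where $x_j^{{\cal V}^\perp}$ is the orthogonal projection of $x_j$ on ${\cal V}^\perp$. For $\epsilon>0$ let $M(\epsilon,X)$ be the smallest $N\ge 1$ such that some $N$-dimensional linear subspace ${\cal V}$ has $\delta({\cal V},X)\le\epsilon$. For a subset $T$ of a Euclidean space, $N(\epsilon,T)$ is the smallest number of balls of radius $\epsilon$ that cover $T$, and ${\cal H}(\epsilon,T):=\log N(\epsilon,T)$; $N(\epsilon,X)$ is the covering number of the set of columns of $X$. Finally ${\rm absconv}(X):=\{X\beta:\ \beta\in\mathbb R^p,\ \|\beta\|_1\le 1\}$. Let $d,q\ge 1$ be integers and $\gamma,W>0$. Consider all $m\times r$ real matrices $\Psi=(\psi_1,\dots,\psi_r)$, for arbitrary $m$ and $r$, such that $\max_j\|\psi_j\|_2\le 1$ and such that $\Psi$ has a nested approximation with parameters $(q,\gamma,W)$: there are linear subspaces ${\cal V}_0\subset{\cal V}_1\subset\cdots$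 of $\mathbb R^m$ with $\dim{\cal V}_k\le q2^k$ for all $k\ge 0$ and $\delta({\cal V}_k,\Psi)\le\gamma 2^{-k/W}$ for all $k\ge 1$. Let $X:=\Psi\otimes\cdots\otimes\Psi$ ($d$ factors) be the $d$-fold tensor (Kronecker) power, an $m^d\times r^d$ matrix, and let ${\cal F}:={\rm absconv}(X)\subset\mathbb R^{m^d}$. (a) There are constants $C>0$ and $\epsilon_0\in(0,1)$, depending only on $d,q,\gamma,W$, such that for all such $\Psi$ (in particular for all $m$ and $r$) and all $0<\epsilon\le\epsilon_0$ $$M(\epsilon,X)\le C\,\epsilon^{-W}\log^{\frac{(d-1)(2+W)}{2}}(1/\epsilon).$$ (b) Let in addition $V\in\mathbb R$ and $A,\epsilon_1>0$. There are constants $C>0$ and $\epsilon_0\in(0,1)$, depending only on $d,q,\gamma,W,V,A,\epsilon_1$, such that for all such $\Psi$ that also satisfy $N(\epsilon,\Psi)\le A\,\epsilon^{-V}$ for all $0<\epsilon\le\epsilon_1$, and for all $0<\epsilon\le\epsilon_0$, $$N(\epsilon,X)\le C\,\epsilon^{-dV}$$ and $${\cal H}(\epsilon,{\cal F})\le C\,\epsilon^{-\frac{2W}{2+W}}\,\log^{d-1}(1/\epsilon)\,\log^{\frac{W}{2+W}}(1/\epsilon).$$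 -/

import Mathlib

open scoped NNReal ENNReal

noncomputable section

namespace TensorEntropy

/-- The `j`-th column of a real matrix, as a vector of Euclidean space. -/
def column {ι κ : Type*} [Fintype ι] (X : Matrix ι κ ℝ) (j : κ) : EuclideanSpace ℝ ι :=
  WithLp.toLp 2 (fun i => X i j)

/-- The set of columns of a matrix. -/
def columnSet {ι κ : Type*} [Fintype ι] (X : Matrix ι κ ℝ) : Set (EuclideanSpace ℝ ι) :=
  Set.range (column X)

/-- The `d`-fold tensor (Kronecker) power `Ψ ⊗ ⋯ ⊗ Ψ`. Rows are indexed by `(i₁, …, i_d)`,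
columns by `(j₁, …, j_d)`, and the column of index `(j₁, …, j_d)` is `ψ_{j₁} ⊗ ⋯ ⊗ ψ_{j_d}`. -/
def tensorPower {m r : ℕ} (d : ℕ) (Ψ : Matrix (Fin m) (Fin r) ℝ) :
    Matrix (Fin d → Fin m) (Fin d → Fin r) ℝ :=
  Matrix.of fun i j => ∏ k, Ψ (i k) (j k)

/-- The absolute convex hull `{X β : ‖β‖₁ ≤ 1}` of the columns of `X`. -/
def absconv {ι κ : Type*} [Fintype ι] [Fintype κ] (X : Matrix ι κ ℝ) :
    Set (EuclideanSpace ℝ ι) :=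
  {f | ∃ β : κ → ℝ, ∑ j, |β j| ≤ 1 ∧ f = WithLp.toLp 2 (X.mulVec β)}

/-- `δ(𝒱, X)`: the largest Euclidean norm of the projection of a column of `X` on the
orthocomplement of `𝒱`. -/
def approximationNumber {ι κ : Type*} [Fintype ι] (𝒱 : Submodule ℝ (EuclideanSpace ℝ ι))
    (X : Matrix ι κ ℝ) : ℝ :=
  ⨆ j, ‖𝒱ᗮ.starProjection (column X j)‖

/-- `M(ε, X)`: the smallest positive dimension of a linear subspace `𝒱` with `δ(𝒱, X) ≤ ε`. -/
def epsApproximation {ι κ : Type*} [Fintype ι] (ε : ℝ) (X : Matrix ι κ ℝ) : ℕ :=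
  sInf {N | 1 ≤ N ∧ ∃ 𝒱 : Submodule ℝ (EuclideanSpace ℝ ι),
    Module.finrank ℝ 𝒱 = N ∧ approximationNumber 𝒱 X ≤ ε}

/-- `N(ε, T)`: the smallest number of balls of radius `ε` in the ambient space that cover `T`
(`⊤` if there is no finite cover). -/
def coveringNumber {E : Type*} [PseudoEMetricSpace E] (ε : ℝ) (T : Set E) : ℝ≥0∞ :=
  (Metric.externalCoveringNumber ε.toNNReal T : ℕ∞)

/-- The entropy `H(ε, T) = log N(ε, T)`, as an extended real. -/
def entropy {E : Type*} [PseudoEMetricSpace E] (ε : ℝ) (T : Set E) : EReal :=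
  ENNReal.log (coveringNumber ε T)

/-- `𝒱₀ ⊆ 𝒱₁ ⊆ ⋯` is a nested approximation for `Ψ` with parameters `(q, γ, W)`.
The dimension of `𝒱_k` is at most `q 2^k`; equality for all `k` is impossible in a
finite-dimensional space. -/
structure IsNestedApproximation {m r : ℕ}
    (𝒱 : ℕ → Submodule ℝ (EuclideanSpace ℝ (Fin m)))
    (Ψ : Matrix (Fin m) (Fin r) ℝ) (q : ℕ) (γ W : ℝ) : Prop where
  nested : ∀ k, 𝒱 k ≤ 𝒱 (k + 1)
  finrank_le : ∀ k, Module.finrank ℝ (𝒱 k) ≤ q * 2 ^ k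
  approx : ∀ k : ℕ, 1 ≤ k → approximationNumber (𝒱 k) Ψ ≤ γ * (2 : ℝ) ^ (-(k : ℝ) / W)

end TensorEntropy

end

/-!
The sum of the products `𝒱_{k₀} ⊗ ⋯ ⊗ 𝒱_{k_{d-1}}` over `k₀ + ⋯ + k_{d-1} = K`, a hyperbolic cross,
has dimension `O(2 ^ K K ^ (d - 1))`. Since the `𝒱_k` are nested, the increments of the projections
of a column on `𝒱_0 ⊆ 𝒱_1 ⊆ ⋯` are orthogonal, so the errors of the successive levels add up in
squares and the cross approximates the tensor columns with squared error
`O(K ^ (d - 1) 4 ^ (-K / W))`. The smallest `K` bringing this below `ε ^ 2` bounds `M(ε, X)`.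

For the entropy, take a subspace `𝒱` that approximates the columns with accuracy `u`. To refine a
net of the absolute convex hull from radius `3ε/2` to `ε`, the component along `𝒱` needs only
`5 ^ dim 𝒱` points per ball, while the component in the orthocomplement lies in the absolute convex
hull of vectors of norm at most `u`, which averages of `O(u ^ 2 / ε ^ 2)` of them approximate
(Maurey). The choice of `u` balances the two contributions, and the refinements from radius `1` down
to `ε` sum up as a geometric series, whereas a direct net of the component along `𝒱` would need
`(1 / ε) ^ dim 𝒱` points.
-/

noncomputable section

namespace TensorEntropy

open Metric Module Set
open scoped Pointwise RealInnerProductSpace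

section Covering

variable {E F : Type*} [PseudoMetricSpace E] [PseudoMetricSpace F] {S T : Set E} {δ ε : ℝ}

theorem coveringNumber_le_encard {N : Set E} (hN : ∀ x ∈ T, ∃ c ∈ N, dist x c ≤ ε) :
    coveringNumber ε T ≤ N.encard := by
  have hcover : IsCover ε.toNNReal T N := isCover_iff_subset_iUnion_closedBall.2 fun x hx ↦ by
    obtain ⟨c, hc, hxc⟩ := hN x hx
    exact mem_biUnion hc (mem_closedBall.2 (hxc.trans (Real.le_coe_toNNReal ε)))
  exact ENat.toENNReal_mono hcover.externalCoveringNumber_le_encard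

theorem exists_cover_encard_eq_coveringNumber (hε : 0 ≤ ε) (T : Set E) :
    ∃ N : Set E, N.encard = coveringNumber ε T ∧ ∀ x ∈ T, ∃ c ∈ N, dist x c ≤ ε := by
  have : Nonempty {N : Set E // IsCover ε.toNNReal T N} := ⟨⟨T, .rfl⟩⟩
  obtain ⟨⟨N, hN⟩, hcard⟩ :=
    ENat.exists_eq_iInf fun N : {N : Set E // IsCover ε.toNNReal T N} ↦ N.1.encard
  refine ⟨N, congrArg _ (hcard.trans iInf_subtype), fun x hx ↦ ?_⟩
  simpa [Real.coe_toNNReal ε hε] using isCover_iff_subset_iUnion_closedBall.1 hN hx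

theorem exists_cover_subset_encard_le_coveringNumber (hε : 0 ≤ ε) (T : Set E) :
    ∃ N ⊆ T, N.encard ≤ coveringNumber ε T ∧ ∀ x ∈ T, ∃ c ∈ N, dist x c ≤ 2 * ε := by
  obtain ⟨N, hcard, hN⟩ := exists_cover_encard_eq_coveringNumber hε T
  have hchoice (c : E) : ∃ y, (∃ x ∈ T, dist x c ≤ ε) → y ∈ T ∧ dist y c ≤ ε := by
    by_cases h : ∃ x ∈ T, dist x c ≤ ε
    exacts [h.imp fun _ hx _ ↦ hx, ⟨c, fun h' ↦ absurd h' h⟩]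
  choose y hy using hchoice
  refine ⟨y '' {c ∈ N | ∃ x ∈ T, dist x c ≤ ε}, ?_, ?_, fun x hx ↦ ?_⟩
  · rintro _ ⟨c, ⟨-, hc⟩, rfl⟩
    exact (hy c hc).1
  · exact hcard ▸ ENat.toENNReal_mono ((encard_image_le _ _).trans (encard_mono (sep_subset _ _)))
  · obtain ⟨c, hc, hxc⟩ := hN x hx
    refine ⟨y c, mem_image_of_mem y ⟨hc, x, hx, hxc⟩, ?_⟩
    linarith [dist_triangle_right x (y c) c, (hy c ⟨x, hx, hxc⟩).2]

theorem coveringNumber_mono (h : S ⊆ T) : coveringNumber ε S ≤ coveringNumber ε T :=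
  ENat.toENNReal_mono (externalCoveringNumber_mono_set h)

theorem coveringNumber_anti (h : δ ≤ ε) : coveringNumber ε T ≤ coveringNumber δ T :=
  ENat.toENNReal_mono (externalCoveringNumber_anti (Real.toNNReal_mono h))

theorem encard_image2_le {α β γ : Type*} (f : α → β → γ) (s : Set α) (t : Set β) :
    (image2 f s t).encard ≤ s.encard * t.encard := by
  rw [← image_uncurry_prod, ← encard_prod]
  exact encard_image_le _ _

theorem coveringNumber_image_le {f : E → F} (hf : ∀ x y, dist (f x) (f y) ≤ dist x y) (hε : 0 ≤ ε)
    (T : Set E) : coveringNumber ε (f '' T) ≤ coveringNumber ε T := by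
  obtain ⟨N, hcard, hN⟩ := exists_cover_encard_eq_coveringNumber hε T
  refine (coveringNumber_le_encard (N := f '' N) ?_).trans
    (hcard ▸ ENat.toENNReal_mono (encard_image_le f N))
  rintro _ ⟨x, hx, rfl⟩
  obtain ⟨c, hc, hxc⟩ := hN x hx
  exact ⟨f c, mem_image_of_mem f hc, (hf x c).trans hxc⟩

end Covering

section NormedCovering

variable {E : Type*} [SeminormedAddCommGroup E] {S T : Set E} {δ ε : ℝ}

theorem coveringNumber_add_le (hδ : 0 ≤ δ) (hε : 0 ≤ ε) (S T : Set E) :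
    coveringNumber (δ + ε) (S + T) ≤ coveringNumber δ S * coveringNumber ε T := by
  obtain ⟨M, hMcard, hM⟩ := exists_cover_encard_eq_coveringNumber hδ S
  obtain ⟨N, hNcard, hN⟩ := exists_cover_encard_eq_coveringNumber hε T
  rw [← hMcard, ← hNcard, ← ENat.toENNReal_mul]
  refine (coveringNumber_le_encard (N := M + N) ?_).trans
    (ENat.toENNReal_mono (encard_image2_le _ M N))
  rintro _ ⟨x, hx, y, hy, rfl⟩
  obtain ⟨a, ha, hxa⟩ := hM x hx
  obtain ⟨b, hb, hyb⟩ := hN y hy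
  exact ⟨a + b, add_mem_add ha hb, (dist_add_add_le x y a b).trans (add_le_add hxa hyb)⟩

theorem coveringNumber_closedBall (x : E) (ε : ℝ) : coveringNumber ε (closedBall x ε) ≤ 1 := by
  refine (coveringNumber_le_encard (N := {x}) fun y hy ↦ ⟨x, rfl, hy⟩).trans ?_
  simp

end NormedCovering

section FiniteDimensional

variable {E : Type*} [NormedAddCommGroup E] [NormedSpace ℝ E] [FiniteDimensional ℝ E]

theorem packingNumber_closedBall_zero_two_le :
    packingNumber 1 (closedBall (0 : E) 2) ≤ (5 ^ finrank ℝ E : ℕ) := by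
  refine iSup_le fun C ↦ iSup₂_le fun hC hsep ↦ ?_
  by_contra! hlarge
  obtain ⟨D, hDC, hD⟩ := exists_subset_encard_eq (Order.add_one_le_of_lt hlarge)
  have hfin : D.Finite := finite_of_encard_eq_coe (k := 5 ^ finrank ℝ E + 1) (by exact_mod_cast hD)
  lift D to Finset E using hfin
  have hcard : D.card ≤ 5 ^ finrank ℝ E := by
    refine Besicovitch.card_le_of_separated D (fun c hc ↦ by simpa using hC (hDC hc)) ?_
    intro c hc d hd hcd
    have hdist := (hsep (hDC hc) (hDC hd) hcd).le
    rwa [ENNReal.coe_one, ← ENNReal.ofReal_one, edist_dist,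
      ENNReal.ofReal_le_ofReal_iff dist_nonneg, dist_eq_norm] at hdist
  rw [encard_coe_eq_coe_finsetCard] at hD
  have : D.card = 5 ^ finrank ℝ E + 1 := by exact_mod_cast hD
  omega

theorem coveringNumber_half_closedBall_zero_le {r : ℝ} (hr : 0 < r) :
    coveringNumber (r / 2) (closedBall (0 : E) r) ≤ 5 ^ finrank ℝ E := by
  have hunit : coveringNumber 1 (closedBall (0 : E) 2) ≤ 5 ^ finrank ℝ E := by
    have hle := (externalCoveringNumber_le_coveringNumber 1 (closedBall (0 : E) 2)).trans
      ((coveringNumber_le_packingNumber _ _).trans packingNumber_closedBall_zero_two_le)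
    simpa [coveringNumber] using ENat.toENNReal_mono hle
  obtain ⟨N, hcard, hN⟩ := exists_cover_encard_eq_coveringNumber zero_le_one (closedBall (0 : E) 2)
  refine (coveringNumber_le_encard (N := (r / 2) • N) fun x hx ↦ ?_).trans
    ((ENat.toENNReal_mono (encard_image_le _ N)).trans (hcard ▸ hunit))
  have hr2 : 0 < r / 2 := half_pos hr
  obtain ⟨c, hc, hxc⟩ := hN ((r / 2)⁻¹ • x) (by
    rw [mem_closedBall_zero_iff] at hx ⊢
    rw [norm_smul, Real.norm_of_nonneg (by positivity), inv_mul_le_iff₀ hr2]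
    linarith)
  refine ⟨(r / 2) • c, smul_mem_smul_set hc, ?_⟩
  rw [← smul_inv_smul₀ hr2.ne' x, dist_smul₀, Real.norm_of_nonneg hr2.le]
  exact mul_le_of_le_one_right hr2.le hxc

theorem coveringNumber_half_le {r : ℝ} (hr : 0 < r) (T : Set E) :
    coveringNumber (r / 2) T ≤ 5 ^ finrank ℝ E * coveringNumber r T := by
  obtain ⟨N, hcard, hN⟩ := exists_cover_encard_eq_coveringNumber hr.le T
  have hT : T ⊆ closedBall 0 r + N := fun x hx ↦ by
    obtain ⟨c, hc, hxc⟩ := hN x hx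
    exact ⟨x - c, by simpa [dist_eq_norm] using hxc, c, hc, by simp⟩
  have hNself : coveringNumber 0 N ≤ N.encard :=
    coveringNumber_le_encard fun x hx ↦ ⟨x, hx, (dist_self x).le⟩
  calc coveringNumber (r / 2) T ≤ coveringNumber (r / 2 + 0) (closedBall 0 r + N) := by
        rw [add_zero]; exact coveringNumber_mono hT
    _ ≤ coveringNumber (r / 2) (closedBall (0 : E) r) * coveringNumber 0 N :=
        coveringNumber_add_le (half_pos hr).le le_rfl _ _
    _ ≤ 5 ^ finrank ℝ E * coveringNumber r T := by
        rw [← hcard]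
        gcongr
        exact coveringNumber_half_closedBall_zero_le hr

end FiniteDimensional

section OrthogonalSplit

variable {E : Type*} [NormedAddCommGroup E] [InnerProductSpace ℝ E]

theorem coveringNumber_half_add_le (𝒱 : Submodule ℝ E) [FiniteDimensional ℝ 𝒱] {r ρ : ℝ}
    (hr : 0 < r) (hρ : 0 ≤ ρ) (T : Set E) :
    coveringNumber (r / 2 + ρ) T ≤
      5 ^ finrank ℝ 𝒱 * coveringNumber r T * coveringNumber ρ (𝒱ᗮ.starProjection '' T) := by
  have hT : T ⊆ 𝒱.starProjection '' T + 𝒱ᗮ.starProjection '' T := fun x hx ↦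
    ⟨_, mem_image_of_mem _ hx, _, mem_image_of_mem _ hx,
      𝒱.starProjection_add_starProjection_orthogonal x⟩
  have hproj : coveringNumber (r / 2) (𝒱.starProjection '' T) ≤
      5 ^ finrank ℝ 𝒱 * coveringNumber r T :=
    calc coveringNumber (r / 2) (𝒱.starProjection '' T)
        = coveringNumber (r / 2) (𝒱.subtype '' (𝒱.orthogonalProjectionOnto '' T)) := by
          rw [image_image]; rfl
      _ ≤ coveringNumber (r / 2) (𝒱.orthogonalProjectionOnto '' T) :=
          coveringNumber_image_le (fun x y ↦ (𝒱.subtypeₗᵢ.isometry.dist_eq x y).le)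
            (half_pos hr).le _
      _ ≤ 5 ^ finrank ℝ 𝒱 * coveringNumber r (𝒱.orthogonalProjectionOnto '' T) :=
          coveringNumber_half_le hr _
      _ ≤ 5 ^ finrank ℝ 𝒱 * coveringNumber r T := by
          gcongr
          refine coveringNumber_image_le (fun x y ↦ ?_) hr.le T
          rw [dist_eq_norm, dist_eq_norm, ← map_sub]
          exact 𝒱.norm_orthogonalProjectionOnto_apply_le (x - y)
  exact ((coveringNumber_mono hT).trans
    (coveringNumber_add_le (half_pos hr).le hρ _ _)).trans (by gcongr)

end OrthogonalSplit

section Maurey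

variable {E : Type*} [NormedAddCommGroup E] [InnerProductSpace ℝ E] {A T : Set E} {u ρ δ : ℝ}

theorem exists_sum_sub_norm_sq_le (hA : A ⊆ closedBall 0 u) {x : E} (hx : x ∈ convexHull ℝ A)
    (k : ℕ) : ∃ z : Fin k → E, (∀ i, z i ∈ A) ∧ ‖∑ i, (z i - x)‖ ^ 2 ≤ k * (2 * u) ^ 2 := by
  induction k with
  | zero => exact ⟨Fin.elim0, fun i ↦ i.elim0, by simp⟩
  | succ k ih =>
    obtain ⟨z, hzA, hz⟩ := ih
    -- Some point of `A` lies on the side of `x` opposite to the error made so far.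
    obtain ⟨a, haA, ha⟩ := ((innerₗ E (∑ i, (z i - x))).concaveOn
      (convex_univ (𝕜 := ℝ))).exists_le_of_mem_convexHull (subset_univ A) hx
    have hax : ‖a - x‖ ≤ 2 * u := by
      have hxu := convexHull_min hA (convex_closedBall 0 u) hx
      have hau := hA haA
      rw [mem_closedBall_zero_iff] at hxu hau
      linarith [norm_sub_le a x]
    refine ⟨Fin.snoc z a, fun i ↦ ?_, ?_⟩
    · cases i using Fin.lastCases with
      | last => simpa only [Fin.snoc_last] using haA
      | cast i => simpa only [Fin.snoc_castSucc] using hzA i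
    · have hinner : ⟪∑ i, (z i - x), a - x⟫ ≤ 0 := by
        rw [inner_sub_right]
        exact sub_nonpos.2 ha
      simp only [Fin.sum_univ_castSucc, Fin.snoc_castSucc, Fin.snoc_last, norm_add_sq_real]
      push_cast
      linarith [pow_le_pow_left₀ (norm_nonneg _) hax 2]

theorem coveringNumber_convexHull_le (hA : A ⊆ closedBall 0 u) (hρ : 0 ≤ ρ) {k : ℕ} (hk : 0 < k)
    (h : (2 * u) ^ 2 ≤ k * ρ ^ 2) : coveringNumber ρ (convexHull ℝ A) ≤ A.encard ^ k := by
  have hk' : (0 : ℝ) < k := Nat.cast_pos.2 hk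
  let average (z : Fin k → E) : E := (k : ℝ)⁻¹ • ∑ i, z i
  have hcard : ((average '' univ.pi fun _ ↦ A).encard : ℝ≥0∞) ≤ A.encard ^ k := by
    refine (ENat.toENNReal_mono (encard_image_le _ _)).trans_eq ?_
    rw [encard_pi_eq_prod_encard, Finset.prod_const, Finset.card_univ, Fintype.card_fin,
      ENat.toENNReal_pow]
  refine (coveringNumber_le_encard fun x hx ↦ ?_).trans hcard
  obtain ⟨z, hzA, hz⟩ := exists_sum_sub_norm_sq_le hA hx k
  refine ⟨average z, mem_image_of_mem _ fun i _ ↦ hzA i, ?_⟩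
  have hdist : k * dist x (average z) = ‖∑ i, (z i - x)‖ := by
    have : ∑ i, (z i - x) = (k : ℝ) • (average z - x) := by
      simp [average, smul_sub, smul_inv_smul₀ hk'.ne', ← Nat.cast_smul_eq_nsmul ℝ]
    rw [this, norm_smul, Real.norm_of_nonneg hk'.le, dist_comm, dist_eq_norm]
  have hsq : (k * dist x (average z)) ^ 2 ≤ (k * ρ) ^ 2 := by
    rw [hdist]
    nlinarith
  exact le_of_mul_le_mul_left ((sq_le_sq₀ (by positivity) (by positivity)).1 hsq) hk'

theorem coveringNumber_absConvexHull_le (hT : T ⊆ closedBall 0 u) (hδ : 0 ≤ δ) (hρ : 0 ≤ ρ) {k : ℕ}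
    (hk : 0 < k) (h : (2 * u) ^ 2 ≤ k * ρ ^ 2) :
    coveringNumber (ρ + 2 * δ) (absConvexHull ℝ T) ≤ (2 * coveringNumber δ T) ^ k := by
  obtain ⟨S, hST, hcard, hS⟩ := exists_cover_subset_encard_le_coveringNumber hδ T
  have hTS : T ⊆ S + closedBall 0 (2 * δ) := fun x hx ↦ by
    obtain ⟨c, hc, hxc⟩ := hS x hx
    exact ⟨c, hc, x - c, by simpa [dist_eq_norm] using hxc, by simp⟩
  have hhull : absConvexHull ℝ T ⊆ convexHull ℝ (S ∪ -S) + closedBall 0 (2 * δ) := by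
    rw [convexHull_union_neg_eq_absConvexHull]
    exact absConvexHull_min (hTS.trans (add_subset_add_right subset_absConvexHull))
      ⟨balanced_absConvexHull.add (balanced_closedBall_zero),
        convex_absConvexHull.add (convex_closedBall 0 _)⟩
  have hsymm : S ∪ -S ⊆ closedBall 0 u := by
    refine union_subset (hST.trans hT) fun x hx ↦ ?_
    simpa using hT (hST hx)
  have hsymm_card : ((S ∪ -S).encard : ℝ≥0∞) ≤ 2 * coveringNumber δ T := by
    have : (S ∪ -S).encard ≤ 2 * S.encard := by
      rw [two_mul]
      refine (encard_union_le S (-S)).trans (add_le_add_right ?_ _)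
      rw [← image_neg_eq_neg]
      exact encard_image_le _ S
    have := ENat.toENNReal_mono this
    rw [ENat.toENNReal_mul] at this
    exact this.trans (mul_le_mul_right hcard 2)
  calc coveringNumber (ρ + 2 * δ) (absConvexHull ℝ T)
      ≤ coveringNumber (ρ + 2 * δ) (convexHull ℝ (S ∪ -S) + closedBall 0 (2 * δ)) :=
        coveringNumber_mono hhull
    _ ≤ coveringNumber ρ (convexHull ℝ (S ∪ -S)) * coveringNumber (2 * δ) (closedBall 0 (2 * δ)) :=
        coveringNumber_add_le hρ (by positivity) _ _
    _ ≤ (S ∪ -S).encard ^ k * 1 := by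
        gcongr
        exacts [coveringNumber_convexHull_le hsymm hρ hk h, coveringNumber_closedBall 0 _]
    _ ≤ (2 * coveringNumber δ T) ^ k := by
        rw [mul_one]
        gcongr

theorem coveringNumber_absConvexHull_refine (𝒱 : Submodule ℝ E) [FiniteDimensional ℝ 𝒱]
    (hu : ∀ x ∈ T, ‖𝒱ᗮ.starProjection x‖ ≤ u) {ε : ℝ} (hε : 0 < ε) {k : ℕ} (hk : 0 < k)
    (hkε : (16 * u) ^ 2 ≤ k * ε ^ 2) :
    coveringNumber ε (absConvexHull ℝ T) ≤ 5 ^ finrank ℝ 𝒱 *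
      coveringNumber (3 / 2 * ε) (absConvexHull ℝ T) * (2 * coveringNumber (ε / 16) T) ^ k := by
  set P := 𝒱ᗮ.starProjection
  have himage : P '' absConvexHull ℝ T ⊆ absConvexHull ℝ (P '' T) := by
    rw [← convexHull_union_neg_eq_absConvexHull, ← convexHull_union_neg_eq_absConvexHull]
    refine (P.toLinearMap.image_convexHull _).subset.trans (convexHull_mono ?_)
    rw [image_union]
    refine union_subset_union_right _ ?_
    rintro _ ⟨x, hx, rfl⟩
    exact ⟨-x, hx, by simp⟩
  have hprojT : coveringNumber (ε / 16) (P '' T) ≤ coveringNumber (ε / 16) T := by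
    refine coveringNumber_image_le (fun x y ↦ ?_) (by positivity) T
    rw [dist_eq_norm, dist_eq_norm, ← map_sub]
    exact 𝒱ᗮ.norm_starProjection_apply_le (x - y)
  have hproj : coveringNumber (ε / 4) (P '' absConvexHull ℝ T) ≤
      (2 * coveringNumber (ε / 16) T) ^ k :=
    calc coveringNumber (ε / 4) (P '' absConvexHull ℝ T)
        ≤ coveringNumber (ε / 8 + 2 * (ε / 16)) (absConvexHull ℝ (P '' T)) := by
          rw [show ε / 8 + 2 * (ε / 16) = ε / 4 by ring]
          exact coveringNumber_mono himage
      _ ≤ (2 * coveringNumber (ε / 16) (P '' T)) ^ k := by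
          refine coveringNumber_absConvexHull_le (u := u) ?_ (by positivity) (by positivity) hk ?_
          · rintro _ ⟨x, hx, rfl⟩
            exact mem_closedBall_zero_iff.2 (hu x hx)
          · linarith
      _ ≤ (2 * coveringNumber (ε / 16) T) ^ k := by gcongr
  calc coveringNumber ε (absConvexHull ℝ T)
      = coveringNumber (3 / 2 * ε / 2 + ε / 4) (absConvexHull ℝ T) := by congr 1; ring
    _ ≤ _ := coveringNumber_half_add_le 𝒱 (by positivity) (by positivity) _
    _ ≤ _ := by gcongr

end Maurey

section Rates

variable {W e ε : ℝ}

/-- The entropy rate `ε ^ (-2W / (2 + W)) * (1 + log (1 / ε)) ^ ((2e + W) / (2 + W))` of the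
absolute convex hull of a set with approximation rate `u ^ (-W) * (1 + log (1 / u)) ^ e`. Here and
below `1 - log ε` replaces `log (1 / ε)` so that the rates stay positive on all of `(0, 1]`. -/
def entropyRate (W e ε : ℝ) : ℝ :=
  ε ^ (-(2 * W / (2 + W))) * (1 - Real.log ε) ^ ((2 * e + W) / (2 + W))

/-- The accuracy `u` that balances the dimension `u ^ (-W) * (1 + log (1 / ε)) ^ e` of an
approximating subspace against the number `u ^ 2 / ε ^ 2` of points of a Maurey average, weighted by
`1 + log (1 / ε)`: both are then equal to `entropyRate W e ε`. -/
def balancedAccuracy (W e ε : ℝ) : ℝ :=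
  ε ^ (2 / (2 + W)) * (1 - Real.log ε) ^ ((e - 1) / (2 + W))

theorem one_le_one_sub_log (hε : ε ∈ Ioc 0 1) : 1 ≤ 1 - Real.log ε := by
  linarith [Real.log_nonpos hε.1.le hε.2]

theorem entropyRate_nonneg (hε : ε ∈ Ioc 0 1) : 0 ≤ entropyRate W e ε :=
  mul_nonneg (Real.rpow_nonneg hε.1.le _)
    (Real.rpow_nonneg (zero_le_one.trans (one_le_one_sub_log hε)) _)

theorem balancedAccuracy_pos (hε : ε ∈ Ioc 0 1) : 0 < balancedAccuracy W e ε :=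
  mul_pos (Real.rpow_pos_of_pos hε.1 _)
    (Real.rpow_pos_of_pos (zero_lt_one.trans_le (one_le_one_sub_log hε)) _)

theorem one_sub_log_balancedAccuracy_le (hW : 0 < W) (he : 0 ≤ e) (hε : ε ∈ Ioc 0 1) :
    1 - Real.log (balancedAccuracy W e ε) ≤ 2 * (1 - Real.log ε) := by
  have hL := one_le_one_sub_log hε
  have hlog : Real.log (balancedAccuracy W e ε) = 2 / (2 + W) * Real.log ε +
      (e - 1) / (2 + W) * Real.log (1 - Real.log ε) := by
    rw [balancedAccuracy, Real.log_mul (Real.rpow_pos_of_pos hε.1 _).ne'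
      (Real.rpow_pos_of_pos (by linarith) _).ne', Real.log_rpow hε.1, Real.log_rpow (by linarith)]
  have hlogL : Real.log (1 - Real.log ε) ≤ -Real.log ε := by
    linarith [Real.log_le_sub_one_of_pos (zero_lt_one.trans_le hL)]
  have hlogL0 : 0 ≤ Real.log (1 - Real.log ε) := Real.log_nonneg hL
  rw [hlog]
  have : 0 ≤ (1 - 2 * Real.log ε + 2 / (2 + W) * Real.log ε +
      (e - 1) / (2 + W) * Real.log (1 - Real.log ε)) * (2 + W) := by
    field_simp
    nlinarith [mul_nonneg he hlogL0]
  linarith [nonneg_of_mul_nonneg_left this (by positivity)]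

theorem balancedAccuracy_rpow_mul (hW : 0 < W) (hε : ε ∈ Ioc 0 1) :
    balancedAccuracy W e ε ^ (-W) * (1 - Real.log ε) ^ e = entropyRate W e ε := by
  have hL : 0 < 1 - Real.log ε := by linarith [one_le_one_sub_log hε]
  have hε0 := hε.1
  rw [balancedAccuracy, entropyRate, Real.mul_rpow (by positivity) (by positivity),
    ← Real.rpow_mul hε0.le, ← Real.rpow_mul hL.le, mul_assoc, ← Real.rpow_add hL]
  congr 2 <;> field_simp
  ring

theorem balancedAccuracy_sq_mul (hW : 0 < W) (hε : ε ∈ Ioc 0 1) :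
    balancedAccuracy W e ε ^ 2 * (1 - Real.log ε) = ε ^ 2 * entropyRate W e ε := by
  have hL : 0 < 1 - Real.log ε := by linarith [one_le_one_sub_log hε]
  have hε0 := hε.1
  have hpow_ε : (ε ^ (2 / (2 + W))) ^ 2 = ε ^ 2 * ε ^ (-(2 * W / (2 + W))) := by
    rw [← Real.rpow_mul_natCast hε0.le, ← Real.rpow_natCast, ← Real.rpow_add hε0]
    congr 1
    push_cast
    field_simp
    ring
  have hpow_log : ((1 - Real.log ε) ^ ((e - 1) / (2 + W))) ^ 2 * (1 - Real.log ε) =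
      (1 - Real.log ε) ^ ((2 * e + W) / (2 + W)) := by
    rw [← Real.rpow_mul_natCast hL.le, ← Real.rpow_add_one hL.ne']
    congr 1
    push_cast
    field_simp
    ring
  rw [balancedAccuracy, entropyRate, mul_pow, hpow_ε, mul_assoc, hpow_log, mul_assoc]

theorem one_sub_log_le_entropyRate (hW : 0 < W) (he : 0 ≤ e) (hε : ε ∈ Ioc 0 1) :
    1 - Real.log ε ≤ (1 + (2 + W) / (2 * W)) * entropyRate W e ε := by
  have hε0 := hε.1
  have hL := one_le_one_sub_log hε
  set p := 2 * W / (2 + W) with hp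
  have hp0 : 0 < p := by positivity
  have hlog : -Real.log ε ≤ (2 + W) / (2 * W) * ε ^ (-p) := by
    have h := Real.log_le_rpow_div (x := ε⁻¹) (by positivity) hp0
    rw [Real.log_inv, Real.inv_rpow hε0.le, ← Real.rpow_neg hε0.le] at h
    refine h.trans_eq ?_
    rw [hp]
    field_simp
  have hone : 1 ≤ ε ^ (-p) :=
    Real.one_le_rpow_of_pos_of_le_one_of_nonpos hε0 hε.2 (neg_nonpos.2 hp0.le)
  calc 1 - Real.log ε ≤ (1 + (2 + W) / (2 * W)) * ε ^ (-p) := by linarith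
    _ ≤ (1 + (2 + W) / (2 * W)) * entropyRate W e ε := by
        gcongr
        exact le_mul_of_one_le_right (by positivity) (Real.one_le_rpow hL (by positivity))

theorem entropyRate_mul_le (hW : 0 < W) (he : 0 ≤ e) {a : ℝ} (ha : 1 ≤ a) (hε : 0 < ε)
    (haε : a * ε ≤ 1) :
    entropyRate W e (a * ε) ≤ a ^ (-(2 * W / (2 + W))) * entropyRate W e ε := by
  have hL := one_le_one_sub_log ⟨by positivity, haε⟩
  have hlog : Real.log ε ≤ Real.log (a * ε) := Real.log_le_log hε (le_mul_of_one_le_left hε.le ha)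
  rw [entropyRate, entropyRate, Real.mul_rpow (by positivity) hε.le, mul_assoc]
  gcongr

theorem exists_maurey_length (hW : 0 < W) (he : 0 ≤ e) (hε : ε ∈ Ioc 0 1) :
    ∃ k : ℕ, 0 < k ∧ (16 * balancedAccuracy W e ε) ^ 2 ≤ k * ε ^ 2 ∧
      k * (1 - Real.log ε) ≤ (258 + (2 + W) / W) * entropyRate W e ε := by
  have hε0 := hε.1
  have hL := one_le_one_sub_log hε
  set x := (16 * balancedAccuracy W e ε / ε) ^ 2 with hx
  refine ⟨⌈x⌉₊ + 1, Nat.succ_pos _, ?_, ?_⟩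
  · rw [← div_le_iff₀ (by positivity), ← div_pow, ← hx]
    exact (Nat.le_ceil x).trans (by simp)
  · have hxL : x * (1 - Real.log ε) = 256 * entropyRate W e ε := by
      have : x * (1 - Real.log ε) =
          256 * (balancedAccuracy W e ε ^ 2 * (1 - Real.log ε)) / ε ^ 2 := by ring
      rw [this, balancedAccuracy_sq_mul hW hε]
      field_simp
    have hk : ((⌈x⌉₊ + 1 : ℕ) : ℝ) ≤ x + 2 := by
      push_cast
      linarith [(Nat.ceil_lt_add_one (sq_nonneg (16 * balancedAccuracy W e ε / ε))).le]
    calc ((⌈x⌉₊ + 1 : ℕ) : ℝ) * (1 - Real.log ε) ≤ (x + 2) * (1 - Real.log ε) := by gcongr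
      _ ≤ 256 * entropyRate W e ε + 2 * ((1 + (2 + W) / (2 * W)) * entropyRate W e ε) := by
          rw [add_mul, hxL]
          gcongr
          exact one_sub_log_le_entropyRate hW he hε
      _ = (258 + (2 + W) / W) * entropyRate W e ε := by
          field_simp
          ring

end Rates

section EntropyOfHulls

theorem le_coe_of_geometric_recursion {h : ℝ → EReal} {F : ℝ → ℝ} {a C θ : ℝ} (ha : 1 < a)
    (hC : 0 ≤ C) (hθ : θ ∈ Ico 0 1) (hF : ∀ ε ∈ Ioc (0 : ℝ) 1, 0 ≤ F ε)
    (hFa : ∀ ε, 0 < ε → a * ε ≤ 1 → F (a * ε) ≤ θ * F ε) (hone : ∀ ε, 1 ≤ ε → h ε ≤ 0)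
    (hrec : ∀ ε ∈ Ioc (0 : ℝ) 1, h ε ≤ h (a * ε) + (C * F ε : ℝ)) {ε : ℝ} (hε : ε ∈ Ioc 0 1) :
    h ε ≤ (C / (1 - θ) * F ε : ℝ) := by
  have hθ' : 0 < 1 - θ := sub_pos.2 hθ.2
  have hC_le : C ≤ C / (1 - θ) := by
    rw [le_div_iff₀ hθ']
    nlinarith [mul_nonneg hC hθ.1]
  have main (n : ℕ) : ∀ ε ∈ Ioc (0 : ℝ) 1, 1 ≤ a ^ n * ε → h ε ≤ (C / (1 - θ) * F ε : ℝ) := by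
    induction n with
    | zero =>
      intro ε hε h1
      refine (hone ε (by simpa using h1)).trans (EReal.coe_nonneg.2 ?_)
      have := hF ε hε
      positivity
    | succ n ih =>
      intro ε hε h1
      have hFε := hF ε hε
      refine (hrec ε hε).trans ?_
      rcases le_total (a * ε) 1 with haε | haε
      · have haε' : a * ε ∈ Ioc 0 1 := ⟨mul_pos (by positivity) hε.1, haε⟩
        refine (add_le_add_left (ih (a * ε) haε' (by rwa [← mul_assoc, ← pow_succ])) _).trans ?_
        rw [← EReal.coe_add, EReal.coe_le_coe_iff]
        calc C / (1 - θ) * F (a * ε) + C * F ε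
            ≤ C / (1 - θ) * (θ * F ε) + C * F ε := by
              gcongr
              exact hFa ε hε.1 haε
          _ = C / (1 - θ) * F ε := by
              field_simp
              ring
      · refine (add_le_add_left (hone _ haε) _).trans ?_
        rw [zero_add, EReal.coe_le_coe_iff]
        gcongr
  obtain ⟨n, hn⟩ := pow_unbounded_of_one_lt ε⁻¹ ha
  exact main n ε hε (by rw [← inv_mul_cancel₀ hε.1.ne']; gcongr; exact hε.1.le)

variable {E : Type*} [NormedAddCommGroup E] [InnerProductSpace ℝ E] {T : Set E}

/-- `T` is approximated with accuracy `u` by subspaces of dimension at most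
`C * u ^ (-W) * (1 + log (1 / u)) ^ e`. -/
def HasApproximationRate (T : Set E) (C W e : ℝ) : Prop :=
  ∀ u ∈ Ioc (0 : ℝ) 1, ∃ (𝒱 : Submodule ℝ E) (_ : FiniteDimensional ℝ 𝒱),
    finrank ℝ 𝒱 ≤ C * (u ^ (-W) * (1 - Real.log u) ^ e) ∧ ∀ x ∈ T, ‖𝒱ᗮ.starProjection x‖ ≤ u

/-- The covering numbers of `T` grow polynomially, with exponent `V`. -/
def HasCoveringRate {E : Type*} [PseudoEMetricSpace E] (T : Set E) (A V : ℝ) : Prop :=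
  ∀ ε ∈ Ioc (0 : ℝ) 1, coveringNumber ε T ≤ ENNReal.ofReal (A * ε ^ (-V))

theorem HasApproximationRate.nonneg {C W e : ℝ} (h : HasApproximationRate T C W e) : 0 ≤ C := by
  obtain ⟨𝒱, -, hdim, -⟩ := h 1 ⟨one_pos, le_rfl⟩
  simpa using (Nat.cast_nonneg _).trans hdim

theorem HasApproximationRate.exists_subspace_balancedAccuracy {C W e ε : ℝ} (hW : 0 < W)
    (he : 0 ≤ e) (hT : T ⊆ closedBall 0 1) (h : HasApproximationRate T C W e) (hε : ε ∈ Ioc 0 1) :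
    ∃ (𝒱 : Submodule ℝ E) (_ : FiniteDimensional ℝ 𝒱),
      finrank ℝ 𝒱 ≤ C * 2 ^ e * entropyRate W e ε ∧
      ∀ x ∈ T, ‖𝒱ᗮ.starProjection x‖ ≤ balancedAccuracy W e ε := by
  have hC := h.nonneg
  have hR := entropyRate_nonneg (W := W) (e := e) hε
  have hu := balancedAccuracy_pos (W := W) (e := e) hε
  have hL := one_le_one_sub_log hε
  rcases le_total (balancedAccuracy W e ε) 1 with hu1 | hu1
  · obtain ⟨𝒱, hfin, hdim, happrox⟩ := h _ ⟨hu, hu1⟩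
    refine ⟨𝒱, hfin, hdim.trans ?_, happrox⟩
    have hlogu := one_le_one_sub_log ⟨hu, hu1⟩
    calc C * (balancedAccuracy W e ε ^ (-W) * (1 - Real.log (balancedAccuracy W e ε)) ^ e)
        ≤ C * (balancedAccuracy W e ε ^ (-W) * (2 * (1 - Real.log ε)) ^ e) := by
          gcongr
          exact one_sub_log_balancedAccuracy_le hW he hε
      _ = C * 2 ^ e * entropyRate W e ε := by
          rw [Real.mul_rpow two_pos.le (by linarith), ← balancedAccuracy_rpow_mul hW hε]
          ring
  · refine ⟨⊥, inferInstance, ?_, fun x hx ↦ ?_⟩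
    · rw [finrank_bot, Nat.cast_zero]
      positivity
    · exact ((⊥ : Submodule ℝ E)ᗮ.norm_starProjection_apply_le x).trans
        ((mem_closedBall_zero_iff.1 (hT hx)).trans hu1)

theorem entropy_absConvexHull_refine (𝒱 : Submodule ℝ E) [FiniteDimensional ℝ 𝒱] {u ε B : ℝ}
    (hu : ∀ x ∈ T, ‖𝒱ᗮ.starProjection x‖ ≤ u) (hε : 0 < ε) {k : ℕ} (hk : 0 < k)
    (hkε : (16 * u) ^ 2 ≤ k * ε ^ 2) (hB : 0 < B)
    (hT : coveringNumber (ε / 16) T ≤ ENNReal.ofReal B) :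
    entropy ε (absConvexHull ℝ T) ≤ entropy (3 / 2 * ε) (absConvexHull ℝ T) +
      (finrank ℝ 𝒱 * Real.log 5 + k * Real.log (2 * B) : ℝ) := by
  have hfactor : 5 ^ finrank ℝ 𝒱 * (2 * coveringNumber (ε / 16) T) ^ k ≤
      ENNReal.ofReal (5 ^ finrank ℝ 𝒱 * (2 * B) ^ k) := by
    rw [ENNReal.ofReal_mul (by positivity), ENNReal.ofReal_pow (by positivity),
      ENNReal.ofReal_pow (by positivity), ENNReal.ofReal_mul (by positivity),
      ENNReal.ofReal_ofNat, ENNReal.ofReal_ofNat]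
    gcongr
  calc entropy ε (absConvexHull ℝ T)
      ≤ ENNReal.log (coveringNumber (3 / 2 * ε) (absConvexHull ℝ T) *
          ENNReal.ofReal (5 ^ finrank ℝ 𝒱 * (2 * B) ^ k)) := by
        refine ENNReal.log_monotone
          ((coveringNumber_absConvexHull_refine 𝒱 hu hε hk hkε).trans ?_)
        rw [mul_comm (5 ^ finrank ℝ 𝒱), mul_assoc]
        gcongr
    _ = _ := by
        rw [ENNReal.log_mul_add, ENNReal.log_ofReal_of_pos (by positivity),
          Real.log_mul (by positivity) (by positivity), Real.log_pow, Real.log_pow]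
        rfl

theorem log_two_mul_mul_rpow_le {A ε : ℝ} (hA : 0 < A) (V : ℝ) (hε : ε ∈ Ioc 0 1) :
    Real.log (2 * (A * (ε / 16) ^ (-V))) ≤
      (|Real.log (2 * A)| + |V| * (Real.log 16 + 1)) * (1 - Real.log ε) := by
  have hε0 := hε.1
  have hL := one_le_one_sub_log hε
  have hlog16 : 0 ≤ Real.log 16 := Real.log_nonneg (by norm_num)
  have hlog : Real.log (2 * (A * (ε / 16) ^ (-V))) =
      Real.log (2 * A) + V * (Real.log 16 - Real.log ε) := by
    rw [← mul_assoc, Real.log_mul (by positivity) (by positivity), Real.log_rpow (by positivity),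
      Real.log_div hε0.ne' (by norm_num)]
    ring
  have hconst : Real.log (2 * A) ≤ |Real.log (2 * A)| * (1 - Real.log ε) :=
    (le_abs_self _).trans (le_mul_of_one_le_right (abs_nonneg _) hL)
  have hpow : V * (Real.log 16 - Real.log ε) ≤ |V| * (Real.log 16 + 1) * (1 - Real.log ε) := by
    rw [mul_assoc]
    refine mul_le_mul (le_abs_self V) ?_ (by linarith) (abs_nonneg V)
    nlinarith
  linarith

theorem entropy_absConvexHull_nonpos (hT : T ⊆ closedBall 0 1) {ε : ℝ} (hε : 1 ≤ ε) :
    entropy ε (absConvexHull ℝ T) ≤ 0 := by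
  have hsub : absConvexHull ℝ T ⊆ closedBall 0 ε :=
    absConvexHull_min (hT.trans (closedBall_subset_closedBall hε))
      ⟨balanced_closedBall_zero, convex_closedBall 0 ε⟩
  simpa [entropy] using
    ENNReal.log_monotone ((coveringNumber_mono hsub).trans (coveringNumber_closedBall 0 ε))

theorem exists_entropy_absConvexHull_le_add {W e A : ℝ} (hW : 0 < W) (he : 0 ≤ e) (C V : ℝ)
    (hA : 0 < A) :
    ∃ C' ≥ 0, ∀ {E : Type*} [NormedAddCommGroup E] [InnerProductSpace ℝ E] {T : Set E},
      T ⊆ closedBall 0 1 → HasApproximationRate T C W e → HasCoveringRate T A V →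
        ∀ ε ∈ Ioc (0 : ℝ) 1, entropy ε (absConvexHull ℝ T) ≤
          entropy (3 / 2 * ε) (absConvexHull ℝ T) + (C' * entropyRate W e ε : ℝ) := by
  set K := |Real.log (2 * A)| + |V| * (Real.log 16 + 1)
  have : 0 ≤ K := add_nonneg (abs_nonneg _)
    (mul_nonneg (abs_nonneg _) (add_nonneg (Real.log_nonneg (by norm_num)) one_pos.le))
  refine ⟨|C| * 2 ^ e * Real.log 5 + (258 + (2 + W) / W) * K, by positivity,
    fun hT happ hcov ε hε ↦ ?_⟩
  have hε0 := hε.1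
  obtain ⟨𝒱, _, hdim, hu⟩ := happ.exists_subspace_balancedAccuracy hW he hT hε
  obtain ⟨k, hk, hk_ge, hk_le⟩ := exists_maurey_length hW he hε
  have hcovε : coveringNumber (ε / 16) _ ≤ ENNReal.ofReal (A * (ε / 16) ^ (-V)) :=
    hcov (ε / 16) ⟨by positivity, by linarith [hε.2]⟩
  refine (entropy_absConvexHull_refine 𝒱 hu hε0 hk hk_ge (by positivity) hcovε).trans
    (add_le_add_right (EReal.coe_le_coe_iff.2 ?_) _)
  have hsubspace : finrank ℝ 𝒱 * Real.log 5 ≤ |C| * 2 ^ e * entropyRate W e ε * Real.log 5 := by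
    rw [abs_of_nonneg happ.nonneg]
    gcongr
  have hmaurey : k * Real.log (2 * (A * (ε / 16) ^ (-V))) ≤
      (258 + (2 + W) / W) * K * entropyRate W e ε :=
    calc k * Real.log (2 * (A * (ε / 16) ^ (-V))) ≤ k * (K * (1 - Real.log ε)) :=
          mul_le_mul_of_nonneg_left (log_two_mul_mul_rpow_le hA V hε) k.cast_nonneg
      _ = K * (k * (1 - Real.log ε)) := by ring
      _ ≤ K * ((258 + (2 + W) / W) * entropyRate W e ε) := by gcongr
      _ = (258 + (2 + W) / W) * K * entropyRate W e ε := by ring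
  linarith

theorem exists_entropy_absConvexHull_le {W e A : ℝ} (hW : 0 < W) (he : 0 ≤ e) (C V : ℝ)
    (hA : 0 < A) :
    ∃ C' ≥ 0, ∀ {E : Type*} [NormedAddCommGroup E] [InnerProductSpace ℝ E] {T : Set E},
      T ⊆ closedBall 0 1 → HasApproximationRate T C W e → HasCoveringRate T A V →
        ∀ ε ∈ Ioc (0 : ℝ) 1,
          entropy ε (absConvexHull ℝ T) ≤ (C' * entropyRate W e ε : ℝ) := by
  obtain ⟨C', hC', hstep⟩ := exists_entropy_absConvexHull_le_add hW he C V hA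
  have hθ : (3 / 2 : ℝ) ^ (-(2 * W / (2 + W))) < 1 :=
    Real.rpow_lt_one_of_one_lt_of_neg (by norm_num) (neg_lt_zero.2 (by positivity))
  refine ⟨C' / (1 - (3 / 2 : ℝ) ^ (-(2 * W / (2 + W)))), div_nonneg hC' (sub_pos.2 hθ).le,
    fun hT happ hcov ε hε ↦ ?_⟩
  exact le_coe_of_geometric_recursion (h := fun ε ↦ entropy ε (absConvexHull ℝ _))
    (by norm_num : (1 : ℝ) < 3 / 2) hC'
    ⟨by positivity, hθ⟩ (fun ε hε ↦ entropyRate_nonneg hε)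
    (fun ε hε h ↦ entropyRate_mul_le hW he (by norm_num) hε h)
    (fun ε h ↦ entropy_absConvexHull_nonpos hT h) (hstep hT happ hcov) hε

end EntropyOfHulls

section Dimension

variable {K M N P ι : Type*} [Field K] [AddCommGroup M] [Module K M] [AddCommGroup N] [Module K N]
  [AddCommGroup P] [Module K P]

theorem finrank_map₂_le (f : M →ₗ[K] N →ₗ[K] P) (p : Submodule K M) (q : Submodule K N)
    [FiniteDimensional K p] [FiniteDimensional K q] :
    finrank K (Submodule.map₂ f p q) ≤ finrank K p * finrank K q := by
  rw [TensorProduct.map₂_eq_range_lift_comp_mapIncl, ← finrank_tensorProduct]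
  exact LinearMap.finrank_range_le _

theorem finrank_finset_sup_le (s : Finset ι) (f : ι → Submodule K M)
    [∀ i, FiniteDimensional K (f i)] :
    finrank K (s.sup f : Submodule K M) ≤ ∑ i ∈ s, finrank K (f i) := by
  classical
  induction s using Finset.induction_on with
  | empty => simp
  | insert a s ha ih =>
    rw [Finset.sup_insert, Finset.sum_insert ha]
    exact (Submodule.finrank_add_le_finrank_add_finrank _ _).trans (by gcongr)

end Dimension

section Orthogonality

variable {E ι : Type*} [NormedAddCommGroup E] [InnerProductSpace ℝ E]

theorem norm_sum_sq_of_pairwise_inner_eq_zero {s : Finset ι} {f : ι → E}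
    (h : (s : Set ι).Pairwise fun i j ↦ ⟪f i, f j⟫ = 0) :
    ‖∑ i ∈ s, f i‖ ^ 2 = ∑ i ∈ s, ‖f i‖ ^ 2 := by
  simp only [← real_inner_self_eq_norm_sq, sum_inner, inner_sum]
  refine Finset.sum_congr rfl fun i hi ↦ Finset.sum_eq_single i (fun j hj hji ↦ h hj hi hji) ?_
  exact fun hi' ↦ absurd hi hi'

theorem norm_orthogonal_starProjection_le {𝒱 : Submodule ℝ E} [𝒱.HasOrthogonalProjection] (x : E)
    {g : E} (hg : g ∈ 𝒱) : ‖𝒱ᗮ.starProjection x‖ ≤ ‖x - g‖ := by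
  rw [← sub_zero (𝒱ᗮ.starProjection x), ← Submodule.starProjection_orthogonal_apply_eq_zero hg,
    ← map_sub]
  exact 𝒱ᗮ.norm_starProjection_apply_le _

variable (V : ℕ → Submodule ℝ E) [∀ k, (V k).HasOrthogonalProjection]

/-- The increments of the orthogonal projections of `x` on a sequence of subspaces. They sum up to
the projections themselves, as the first increment is the projection on `V 0`. -/
def projIncrement (x : E) : ℕ → E
  | 0 => (V 0).starProjection x
  | k + 1 => (V (k + 1)).starProjection x - (V k).starProjection x

theorem sum_projIncrement (x : E) (K : ℕ) :
    ∑ k ∈ Finset.range (K + 1), projIncrement V x k = (V K).starProjection x := by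
  rw [Finset.sum_range_succ', projIncrement]
  simp only [projIncrement, Finset.sum_range_sub (fun k ↦ (V k).starProjection x),
    sub_add_cancel]

variable {V}

theorem projIncrement_mem (hV : Monotone V) (x : E) : ∀ k, projIncrement V x k ∈ V k
  | 0 => Submodule.starProjection_apply_mem _ _
  | k + 1 => sub_mem (Submodule.starProjection_apply_mem _ _)
      (hV k.le_succ (Submodule.starProjection_apply_mem _ _))

theorem inner_sub_starProjection_eq_zero (hV : Monotone V) {k n : ℕ} (hkn : k ≤ n) {a : E}
    (ha : a ∈ V k) (x : E) : ⟪a, x - (V n).starProjection x⟫ = 0 :=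
  (Submodule.mem_orthogonal _ _).1 (Submodule.sub_starProjection_mem_orthogonal _) a (hV hkn ha)

theorem inner_projIncrement_of_lt (hV : Monotone V) (x : E) {k n : ℕ} (hkn : k < n) :
    ⟪projIncrement V x k, projIncrement V x n⟫ = 0 := by
  obtain ⟨n, rfl⟩ := Nat.exists_eq_add_one_of_ne_zero hkn.ne_bot
  have hsplit : projIncrement V x (n + 1) =
      (x - (V n).starProjection x) - (x - (V (n + 1)).starProjection x) := by
    rw [projIncrement, sub_sub_sub_cancel_left]
  rw [hsplit, inner_sub_right,
    inner_sub_starProjection_eq_zero hV (Nat.le_of_lt_succ hkn) (projIncrement_mem hV x k),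
    inner_sub_starProjection_eq_zero hV hkn.le (projIncrement_mem hV x k), sub_zero]

theorem inner_projIncrement_of_ne (hV : Monotone V) (x : E) {k n : ℕ} (hkn : k ≠ n) :
    ⟪projIncrement V x k, projIncrement V x n⟫ = 0 :=
  hkn.lt_or_gt.elim (inner_projIncrement_of_lt hV x) fun h ↦
    real_inner_comm (projIncrement V x n) _ ▸ inner_projIncrement_of_lt hV x h

theorem norm_projIncrement_succ_le (hV : Monotone V) (x : E) (k : ℕ) :
    ‖projIncrement V x (k + 1)‖ ≤ ‖x - (V k).starProjection x‖ := by
  have hproj : projIncrement V x (k + 1) =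
      (V (k + 1)).starProjection (x - (V k).starProjection x) := by
    rw [projIncrement, map_sub, Submodule.starProjection_eq_self_iff.2
      (hV k.le_succ (Submodule.starProjection_apply_mem _ _))]
  exact hproj ▸ Submodule.norm_starProjection_apply_le _ _

theorem norm_projIncrement_le (hV : Monotone V) {M s : ℝ} (hM : 0 ≤ M) (hs : 0 < s) (hs1 : s ≤ 1)
    {x : E} (hxM : ‖x‖ ≤ M) (hx : ∀ k, ‖x - (V k).starProjection x‖ ≤ M * s ^ k) (k : ℕ) :
    ‖projIncrement V x k‖ ≤ M / s * s ^ k := by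
  cases k with
  | zero =>
    calc ‖projIncrement V x 0‖ ≤ ‖x‖ := Submodule.norm_starProjection_apply_le _ _
      _ ≤ M / s * s ^ 0 := by rw [pow_zero, mul_one]; exact hxM.trans (le_div_self hM hs hs1)
  | succ k =>
    calc ‖projIncrement V x (k + 1)‖ ≤ M * s ^ k := (norm_projIncrement_succ_le hV x k).trans (hx k)
      _ = M / s * s ^ (k + 1) := by rw [pow_succ]; field_simp

end Orthogonality

section CrossSum

open Finset.HasAntidiagonal (antidiagonal mem_antidiagonal)

variable {E F G : Type*} [NormedAddCommGroup E] [InnerProductSpace ℝ E] [NormedAddCommGroup F]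
  [InnerProductSpace ℝ F] [NormedAddCommGroup G] [InnerProductSpace ℝ G]
  (B : E →ₗ[ℝ] F →ₗ[ℝ] G) (V : ℕ → Submodule ℝ E) (U : ℕ → Submodule ℝ F)

/-- The level `K` of the hyperbolic cross built from two scales of subspaces: the sum of the
products `V i ⊗ U j` with `i + j = K`, where the bilinear map `B` stands for `⊗`. -/
def crossSum (K : ℕ) : Submodule ℝ G :=
  (antidiagonal K).sup fun p ↦ Submodule.map₂ B (V p.1) (U p.2)

theorem finrank_crossSum_le [FiniteDimensional ℝ E] [FiniteDimensional ℝ F] [FiniteDimensional ℝ G]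
    {q Q D : ℕ} (hV : ∀ k, finrank ℝ (V k) ≤ q * 2 ^ k)
    (hU : ∀ k, finrank ℝ (U k) ≤ Q * 2 ^ k * (k + 1) ^ D) (K : ℕ) :
    finrank ℝ (crossSum B V U K) ≤ q * Q * 2 ^ K * (K + 1) ^ (D + 1) := by
  have hterm (p) (hp : p ∈ antidiagonal K) :
      finrank ℝ (Submodule.map₂ B (V p.1) (U p.2)) ≤ q * Q * 2 ^ K * (K + 1) ^ D := by
    obtain rfl := mem_antidiagonal.1 hp
    calc finrank ℝ (Submodule.map₂ B (V p.1) (U p.2))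
        ≤ (q * 2 ^ p.1) * (Q * 2 ^ p.2 * (p.2 + 1) ^ D) :=
          (finrank_map₂_le _ _ _).trans (Nat.mul_le_mul (hV _) (hU _))
      _ ≤ (q * 2 ^ p.1) * (Q * 2 ^ p.2 * (p.1 + p.2 + 1) ^ D) := by gcongr; omega
      _ = q * Q * 2 ^ (p.1 + p.2) * (p.1 + p.2 + 1) ^ D := by ring
  calc finrank ℝ (crossSum B V U K)
      ≤ ∑ p ∈ antidiagonal K, finrank ℝ (Submodule.map₂ B (V p.1) (U p.2)) :=
        finrank_finset_sup_le _ _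
    _ ≤ (antidiagonal K).card * (q * Q * 2 ^ K * (K + 1) ^ D) :=
        Finset.sum_le_card_nsmul _ _ _ hterm
    _ = q * Q * 2 ^ K * (K + 1) ^ (D + 1) := by rw [Finset.Nat.card_antidiagonal]; ring

variable {B V U} [∀ k, (V k).HasOrthogonalProjection]
  (hB : ∀ x x' y y', ⟪B x y, B x' y'⟫ = ⟪x, x'⟫ * ⟪y, y'⟫)
include hB

theorem norm_apply_sq_of_inner_eq_mul (x : E) (y : F) : ‖B x y‖ ^ 2 = ‖x‖ ^ 2 * ‖y‖ ^ 2 := by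
  simp only [← real_inner_self_eq_norm_sq, hB]

theorem norm_apply_sub_sum_antidiagonal_sq (hV : Monotone V) (x : E) (y : F) (g : ℕ → F) (K : ℕ) :
    ‖B x y - ∑ p ∈ antidiagonal K, B (projIncrement V x p.1) (g p.2)‖ ^ 2 =
      ∑ p ∈ antidiagonal K, ‖projIncrement V x p.1‖ ^ 2 * ‖y - g p.2‖ ^ 2 +
        ‖x - (V K).starProjection x‖ ^ 2 * ‖y‖ ^ 2 := by
  have hsplit : B x y - ∑ p ∈ antidiagonal K, B (projIncrement V x p.1) (g p.2) =
      ∑ p ∈ antidiagonal K, B (projIncrement V x p.1) (y - g p.2) +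
        B (x - (V K).starProjection x) y := by
    have hsum : B ((V K).starProjection x) y =
        ∑ p ∈ antidiagonal K, B (projIncrement V x p.1) y := by
      rw [← sum_projIncrement V x K, map_sum, LinearMap.sum_apply,
        Finset.Nat.sum_antidiagonal_eq_sum_range_succ_mk]
    simp only [map_sub, LinearMap.sub_apply, Finset.sum_sub_distrib, hsum]
    abel
  have hcross : ⟪∑ p ∈ antidiagonal K, B (projIncrement V x p.1) (y - g p.2),
      B (x - (V K).starProjection x) y⟫ = 0 := by
    refine (sum_inner _ _ _).trans (Finset.sum_eq_zero fun p hp ↦ ?_)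
    rw [hB, inner_sub_starProjection_eq_zero hV (mem_antidiagonal.1 hp ▸ Nat.le_add_right _ _)
      (projIncrement_mem hV x p.1), zero_mul]
  have hpairwise : (antidiagonal K : Set (ℕ × ℕ)).Pairwise fun p p' ↦
      ⟪B (projIncrement V x p.1) (y - g p.2), B (projIncrement V x p'.1) (y - g p'.2)⟫ = 0 := by
    intro p hp p' hp' hne
    rw [hB, inner_projIncrement_of_ne hV x, zero_mul]
    have hp := mem_antidiagonal.1 hp
    have hp' := mem_antidiagonal.1 hp'
    exact fun h ↦ hne (Prod.ext h (by omega))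
  rw [hsplit, norm_add_sq_real, hcross, norm_sum_sq_of_pairwise_inner_eq_zero hpairwise]
  simp only [norm_apply_sq_of_inner_eq_mul hB, mul_zero, add_zero]

theorem exists_mem_crossSum_norm_sub_sq_le (hV : Monotone V) {H c s : ℝ} {D : ℕ} (hc : 0 ≤ c)
    {x : E} {y : F} (hΔ : ∀ k, ‖projIncrement V x k‖ ≤ H * s ^ k)
    (hx : ∀ k, ‖x - (V k).starProjection x‖ ≤ H * s ^ k) (hy : ‖y‖ ≤ 1)
    (hU : ∀ k : ℕ, ∃ g ∈ U k, ‖y - g‖ ^ 2 ≤ c * (k + 1) ^ D * (s ^ k) ^ 2) (K : ℕ) :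
    ∃ g ∈ crossSum B V U K,
      ‖B x y - g‖ ^ 2 ≤ H ^ 2 * (c + 1) * (K + 1) ^ (D + 1) * (s ^ K) ^ 2 := by
  choose g hgU hg using hU
  have hterm (p) (hp : p ∈ antidiagonal K) :
      ‖projIncrement V x p.1‖ ^ 2 * ‖y - g p.2‖ ^ 2 ≤ H ^ 2 * c * (K + 1) ^ D * (s ^ K) ^ 2 := by
    obtain rfl := mem_antidiagonal.1 hp
    calc ‖projIncrement V x p.1‖ ^ 2 * ‖y - g p.2‖ ^ 2
        ≤ (H * s ^ p.1) ^ 2 * (c * (p.2 + 1) ^ D * (s ^ p.2) ^ 2) := by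
          gcongr
          exacts [hΔ _, hg _]
      _ ≤ (H * s ^ p.1) ^ 2 * (c * ((p.1 + p.2 : ℕ) + 1) ^ D * (s ^ p.2) ^ 2) := by
          gcongr
          omega
      _ = H ^ 2 * c * ((p.1 + p.2 : ℕ) + 1) ^ D * (s ^ (p.1 + p.2)) ^ 2 := by ring
  have hlast : ‖x - (V K).starProjection x‖ ^ 2 * ‖y‖ ^ 2 ≤ (H * s ^ K) ^ 2 :=
    (mul_le_of_le_one_right (sq_nonneg _) (pow_le_one₀ (norm_nonneg y) hy)).trans
      (pow_le_pow_left₀ (norm_nonneg _) (hx K) 2)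
  refine ⟨_, Submodule.sum_mem _ fun p hp ↦ Finset.le_sup
    (f := fun p : ℕ × ℕ ↦ Submodule.map₂ B (V p.1) (U p.2)) hp
    (Submodule.apply_mem_map₂ _ (projIncrement_mem hV x p.1) (hgU p.2)), ?_⟩
  rw [norm_apply_sub_sum_antidiagonal_sq hB hV]
  have hsum := Finset.sum_le_card_nsmul _ _ _ hterm
  rw [Finset.Nat.card_antidiagonal, nsmul_eq_mul] at hsum
  have hpow : (1 : ℝ) ≤ (K + 1) ^ (D + 1) := one_le_pow₀ (by linarith [K.cast_nonneg (α := ℝ)])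
  calc _ ≤ (K + 1 : ℕ) * (H ^ 2 * c * (K + 1) ^ D * (s ^ K) ^ 2) + (H * s ^ K) ^ 2 :=
        add_le_add hsum hlast
    _ ≤ (K + 1 : ℕ) * (H ^ 2 * c * (K + 1) ^ D * (s ^ K) ^ 2) +
          (K + 1) ^ (D + 1) * (H * s ^ K) ^ 2 := by
        gcongr
        exact le_mul_of_one_le_left (sq_nonneg _) hpow
    _ = H ^ 2 * (c + 1) * (K + 1) ^ (D + 1) * (s ^ K) ^ 2 := by push_cast; ring

end CrossSum

section TensorPower

variable {m r d : ℕ}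

/-- The tensor product `x ⊗ y`, with the index of `x` put first. -/
def tensorCons : EuclideanSpace ℝ (Fin m) →ₗ[ℝ] EuclideanSpace ℝ (Fin d → Fin m) →ₗ[ℝ]
    EuclideanSpace ℝ (Fin (d + 1) → Fin m) :=
  LinearMap.mk₂ ℝ (fun x y ↦ WithLp.toLp 2 fun i ↦ x (i 0) * y (Fin.tail i))
    (fun _ _ _ ↦ by ext; simp [add_mul])
    (fun _ _ _ ↦ by ext; simp [mul_assoc])
    (fun _ _ _ ↦ by ext; simp [mul_add])
    (fun _ _ _ ↦ by ext; simp [mul_left_comm])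

theorem tensorCons_apply (x : EuclideanSpace ℝ (Fin m)) (y : EuclideanSpace ℝ (Fin d → Fin m))
    (i : Fin (d + 1) → Fin m) : tensorCons x y i = x (i 0) * y (Fin.tail i) := rfl

theorem inner_tensorCons (x x' : EuclideanSpace ℝ (Fin m))
    (y y' : EuclideanSpace ℝ (Fin d → Fin m)) :
    ⟪tensorCons x y, tensorCons x' y'⟫ = ⟪x, x'⟫ * ⟪y, y'⟫ := by
  simp only [PiLp.inner_apply, tensorCons_apply]
  rw [← (Fin.consEquiv fun _ : Fin (d + 1) ↦ Fin m).sum_comp, Fintype.sum_prod_type,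
    Finset.sum_mul_sum]
  refine Finset.sum_congr rfl fun a _ ↦ Finset.sum_congr rfl fun b _ ↦ ?_
  simp only [Fin.consEquiv, Equiv.coe_fn_mk, Fin.cons_zero, Fin.tail_cons, RCLike.inner_apply,
    conj_trivial]
  ring

theorem norm_tensorCons (x : EuclideanSpace ℝ (Fin m)) (y : EuclideanSpace ℝ (Fin d → Fin m)) :
    ‖tensorCons x y‖ = ‖x‖ * ‖y‖ := by
  rw [← sq_eq_sq₀ (norm_nonneg _) (by positivity), mul_pow,
    norm_apply_sq_of_inner_eq_mul inner_tensorCons]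

theorem dist_tensorCons_le {x x' : EuclideanSpace ℝ (Fin m)}
    {y y' : EuclideanSpace ℝ (Fin d → Fin m)} (hx' : ‖x'‖ ≤ 1) (hy : ‖y‖ ≤ 1) :
    dist (tensorCons x y) (tensorCons x' y') ≤ dist x x' + dist y y' := by
  have hsplit : tensorCons x y - tensorCons x' y' =
      tensorCons (x - x') y + tensorCons x' (y - y') := by
    simp only [map_sub, LinearMap.sub_apply]
    abel
  rw [dist_eq_norm, dist_eq_norm, dist_eq_norm, hsplit]
  refine (norm_add_le _ _).trans ?_
  rw [norm_tensorCons, norm_tensorCons]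
  exact add_le_add (mul_le_of_le_one_right (norm_nonneg _) hy)
    (mul_le_of_le_one_left (norm_nonneg _) hx')

theorem column_tensorPower_succ (Ψ : Matrix (Fin m) (Fin r) ℝ) (j : Fin (d + 1) → Fin r) :
    column (tensorPower (d + 1) Ψ) j =
      tensorCons (column Ψ (j 0)) (column (tensorPower d Ψ) (Fin.tail j)) := by
  ext i
  simp [tensorCons_apply, column, tensorPower, Fin.prod_univ_succ, Fin.tail]

variable {Ψ : Matrix (Fin m) (Fin r) ℝ} (hΨ : ∀ j, ‖column Ψ j‖ ≤ 1)
include hΨ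

theorem norm_column_tensorPower_le : ∀ {d : ℕ} (j : Fin d → Fin r),
    ‖column (tensorPower d Ψ) j‖ ≤ 1
  | 0, j => by simp [EuclideanSpace.norm_eq, column, tensorPower]
  | d + 1, j => by
    rw [column_tensorPower_succ, norm_tensorCons]
    exact mul_le_one₀ (hΨ _) (norm_nonneg _) (norm_column_tensorPower_le _)

theorem columnSet_tensorPower_subset_closedBall (d : ℕ) :
    columnSet (tensorPower d Ψ) ⊆ closedBall 0 1 :=
  range_subset_iff.2 fun j ↦ mem_closedBall_zero_iff.2 (norm_column_tensorPower_le hΨ j)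

theorem exists_cover_columnSet_tensorPower {S : Set (EuclideanSpace ℝ (Fin m))}
    (hS : S ⊆ columnSet Ψ) {ρ : ℝ} (hcover : ∀ x ∈ columnSet Ψ, ∃ c ∈ S, dist x c ≤ ρ) (d : ℕ) :
    ∃ N : Set (EuclideanSpace ℝ (Fin d → Fin m)), N.encard ≤ S.encard ^ d ∧
      ∀ x ∈ columnSet (tensorPower d Ψ), ∃ c ∈ N, dist x c ≤ d * ρ := by
  induction d with
  | zero =>
    exact ⟨columnSet (tensorPower 0 Ψ),
      (encard_le_one_iff_subsingleton.2 (subsingleton_range _)).trans_eq (pow_zero _).symm,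
      fun x hx ↦ ⟨x, hx, by simp⟩⟩
  | succ d ih =>
    obtain ⟨N, hcard, hN⟩ := ih
    refine ⟨image2 (fun x y ↦ tensorCons x y) S N, ?_, ?_⟩
    · rw [pow_succ']
      exact (encard_image2_le _ _ _).trans (by gcongr)
    · rintro _ ⟨j, rfl⟩
      obtain ⟨x, hx, hjx⟩ := hcover _ ⟨j 0, rfl⟩
      obtain ⟨y, hy, hjy⟩ := hN _ ⟨Fin.tail j, rfl⟩
      obtain ⟨i, rfl⟩ := hS hx
      refine ⟨_, mem_image2_of_mem hx hy, ?_⟩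
      rw [column_tensorPower_succ]
      refine (dist_tensorCons_le (hΨ i) (norm_column_tensorPower_le hΨ _)).trans ?_
      push_cast
      linarith

theorem coveringNumber_columnSet_tensorPower_le {δ : ℝ} (hδ : 0 ≤ δ) (d : ℕ) :
    coveringNumber (d * (2 * δ)) (columnSet (tensorPower d Ψ)) ≤
      coveringNumber δ (columnSet Ψ) ^ d := by
  obtain ⟨S, hS, hcard, hcover⟩ := exists_cover_subset_encard_le_coveringNumber hδ (columnSet Ψ)
  obtain ⟨N, hNcard, hN⟩ := exists_cover_columnSet_tensorPower hΨ hS hcover d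
  calc coveringNumber (d * (2 * δ)) (columnSet (tensorPower d Ψ)) ≤ N.encard :=
        coveringNumber_le_encard hN
    _ ≤ (S.encard : ℝ≥0∞) ^ d := by exact_mod_cast hNcard
    _ ≤ coveringNumber δ (columnSet Ψ) ^ d := by gcongr

end TensorPower

theorem exists_hasCoveringRate_tensorPower (d : ℕ) (V : ℝ) {A ε₁ : ℝ} (hA : 0 < A) (hε₁ : 0 < ε₁) :
    ∃ A' > 0, ∀ {m r : ℕ} {Ψ : Matrix (Fin m) (Fin r) ℝ}, (∀ j, ‖column Ψ j‖ ≤ 1) →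
      (∀ ε, 0 < ε → ε ≤ ε₁ → coveringNumber ε (columnSet Ψ) ≤ ENNReal.ofReal (A * ε ^ (-V))) →
      HasCoveringRate (columnSet (tensorPower d Ψ)) A' (d * V) := by
  set κ := min (2 * d + 1 : ℝ)⁻¹ ε₁
  have hκ : 0 < κ := lt_min (by positivity) hε₁
  have hκd : κ * (2 * d + 1) ≤ 1 :=
    (mul_le_mul_of_nonneg_right (min_le_left _ _) (by positivity)).trans_eq
      (inv_mul_cancel₀ (by positivity))
  refine ⟨(A * κ ^ (-V)) ^ d, by positivity, ?_⟩
  rintro m r Ψ hΨ h ε ⟨hε, hε1⟩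
  have hscale : d * (2 * (κ * ε)) ≤ ε := by nlinarith
  have hκε : κ * ε ≤ ε₁ := (mul_le_of_le_one_right hκ.le hε1).trans (min_le_right _ _)
  calc coveringNumber ε (columnSet (tensorPower d Ψ))
      ≤ coveringNumber (d * (2 * (κ * ε))) (columnSet (tensorPower d Ψ)) :=
        coveringNumber_anti hscale
    _ ≤ coveringNumber (κ * ε) (columnSet Ψ) ^ d :=
        coveringNumber_columnSet_tensorPower_le hΨ (by positivity) d
    _ ≤ ENNReal.ofReal (A * (κ * ε) ^ (-V)) ^ d := by
        gcongr
        exact h _ (by positivity) hκε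
    _ = ENNReal.ofReal ((A * κ ^ (-V)) ^ d * ε ^ (-(d * V))) := by
        rw [← ENNReal.ofReal_pow (by positivity), Real.mul_rpow hκ.le hε.le, ← mul_assoc, mul_pow,
          ← Real.rpow_mul_natCast hε.le]
        congr 3
        ring

section HyperbolicCross

variable {m r : ℕ}

/-- The hyperbolic cross of level `K` in the `(d + 1)`-fold tensor power: the sum of the products
`V k₀ ⊗ ⋯ ⊗ V k_d` with `k₀ + ⋯ + k_d = K`. The last slot of `tensorCons` is one-dimensional when
`d = 0`. -/
def hyperbolicCross (V : ℕ → Submodule ℝ (EuclideanSpace ℝ (Fin m))) :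
    ∀ d : ℕ, ℕ → Submodule ℝ (EuclideanSpace ℝ (Fin (d + 1) → Fin m))
  | 0 => fun K ↦ Submodule.map₂ tensorCons (V K) ⊤
  | d + 1 => crossSum tensorCons V (hyperbolicCross V d)

variable {V : ℕ → Submodule ℝ (EuclideanSpace ℝ (Fin m))}

theorem finrank_hyperbolicCross_le {q : ℕ} (hV : ∀ k, finrank ℝ (V k) ≤ q * 2 ^ k) :
    ∀ d K, finrank ℝ (hyperbolicCross V d K) ≤ q ^ (d + 1) * 2 ^ K * (K + 1) ^ d
  | 0, K => by
    refine (finrank_map₂_le tensorCons (V K) ⊤).trans ?_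
    simpa only [finrank_top, finrank_euclideanSpace, Fintype.card_unique, zero_add, pow_one,
      pow_zero, mul_one] using hV K
  | d + 1, K => by
    rw [pow_succ']
    exact finrank_crossSum_le tensorCons V _ hV (finrank_hyperbolicCross_le hV d) K

theorem exists_mem_hyperbolicCross_norm_sub_sq_le (hV : Monotone V)
    {Ψ : Matrix (Fin m) (Fin r) ℝ} (hΨ : ∀ j, ‖column Ψ j‖ ≤ 1) {M s : ℝ} (hM : 1 ≤ M) (hs : 0 < s)
    (hs1 : s ≤ 1)
    (happrox : ∀ j k, ‖column Ψ j - (V k).starProjection (column Ψ j)‖ ≤ M * s ^ k) :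
    ∀ d K (j : Fin (d + 1) → Fin r), ∃ g ∈ hyperbolicCross V d K,
      ‖column (tensorPower (d + 1) Ψ) j - g‖ ^ 2 ≤
        (2 * (M / s) ^ 2) ^ (d + 1) * (K + 1) ^ d * (s ^ K) ^ 2 := by
  have hM0 : 0 ≤ M := zero_le_one.trans hM
  have hMs : M ≤ M / s := le_div_self hM0 hs hs1
  have happrox' (j k) : ‖column Ψ j - (V k).starProjection (column Ψ j)‖ ≤ M / s * s ^ k :=
    (happrox j k).trans (by gcongr)
  intro d
  induction d with
  | zero =>
    intro K j
    refine ⟨tensorCons ((V K).starProjection (column Ψ (j 0)))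
      (column (tensorPower 0 Ψ) (Fin.tail j)),
      Submodule.apply_mem_map₂ _ (Submodule.starProjection_apply_mem _ _) trivial, ?_⟩
    rw [column_tensorPower_succ, ← LinearMap.sub_apply, ← map_sub, norm_tensorCons]
    calc _ ≤ (M / s * s ^ K * 1) ^ 2 := by
          gcongr
          exacts [happrox' _ _, norm_column_tensorPower_le hΨ _]
      _ ≤ 2 * (M / s * s ^ K * 1) ^ 2 := by linarith [sq_nonneg (M / s * s ^ K * 1)]
      _ = _ := by push_cast; ring
  | succ d ih =>
    intro K j
    obtain ⟨g, hg, hle⟩ := exists_mem_crossSum_norm_sub_sq_le (U := hyperbolicCross V d)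
      inner_tensorCons hV (by positivity)
      (norm_projIncrement_le hV hM0 hs hs1 ((hΨ (j 0)).trans hM) (happrox (j 0)))
      (happrox' (j 0)) (norm_column_tensorPower_le hΨ (Fin.tail j)) (fun k ↦ ih k (Fin.tail j)) K
    refine ⟨g, hg, column_tensorPower_succ Ψ j ▸ hle.trans ?_⟩
    have hMs1 : 1 ≤ (M / s) ^ 2 := one_le_pow₀ (hM.trans hMs)
    have hc : 1 ≤ (2 * (M / s) ^ 2) ^ (d + 1) := one_le_pow₀ (by linarith)
    calc _ ≤ (M / s) ^ 2 * (2 * (2 * (M / s) ^ 2) ^ (d + 1)) * (K + 1) ^ (d + 1) * (s ^ K) ^ 2 := by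
          gcongr
          linarith
      _ = _ := by ring

theorem IsNestedApproximation.norm_sub_starProjection_le {Ψ : Matrix (Fin m) (Fin r) ℝ} {q : ℕ}
    {γ W : ℝ} (hV : IsNestedApproximation V Ψ q γ W) (hΨ : ∀ j, ‖column Ψ j‖ ≤ 1) (j : Fin r)
    (k : ℕ) :
    ‖column Ψ j - (V k).starProjection (column Ψ j)‖ ≤ max 1 γ * ((2 : ℝ) ^ (-1 / W)) ^ k := by
  rw [← Submodule.starProjection_orthogonal_val]
  cases k with
  | zero =>
    rw [pow_zero, mul_one]
    exact ((V 0)ᗮ.norm_starProjection_apply_le _).trans ((hΨ j).trans (le_max_left _ _))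
  | succ k =>
    calc ‖(V (k + 1))ᗮ.starProjection (column Ψ j)‖ ≤ approximationNumber (V (k + 1)) Ψ :=
          le_ciSup (f := fun j ↦ ‖(V (k + 1))ᗮ.starProjection (column Ψ j)‖)
            (finite_range _).bddAbove j
      _ ≤ γ * (2 : ℝ) ^ (-((k + 1 : ℕ) : ℝ) / W) := hV.approx _ k.succ_pos
      _ = γ * ((2 : ℝ) ^ (-1 / W)) ^ (k + 1) := by
          rw [← Real.rpow_mul_natCast zero_le_two]
          congr 2
          ring
      _ ≤ max 1 γ * ((2 : ℝ) ^ (-1 / W)) ^ (k + 1) := by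
          gcongr
          exact le_max_right _ _

end HyperbolicCross

section Level

open Filter Topology

variable {s : ℝ} (hs : s ∈ Ioo 0 1) (D : ℕ)
include hs

theorem tendsto_succ_pow_mul_pow :
    Tendsto (fun K : ℕ ↦ ((K : ℝ) + 1) ^ D * s ^ K) atTop (𝓝 0) := by
  have h := ((tendsto_pow_const_mul_const_pow_of_abs_lt_one D
    (abs_lt.2 ⟨by linarith [hs.1], hs.2⟩)).comp (tendsto_add_atTop_nat 1)).div_const s
  rw [zero_div] at h
  refine h.congr fun K ↦ ?_
  have := hs.1.ne'
  simp only [Function.comp_apply, Nat.cast_add, Nat.cast_one, pow_succ s]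
  field_simp

theorem exists_nearly_optimal_level {c u : ℝ} (hu : u ∈ Ioc 0 1) : ∃ K : ℕ,
    c * (K + 1) ^ D * (s ^ K) ^ 2 ≤ u ^ 2 ∧
      u ^ 2 ≤ max 1 (c / s ^ 2) * (K + 1) ^ D * (s ^ K) ^ 2 := by
  classical
  have hexists : ∃ K : ℕ, c * (K + 1) ^ D * (s ^ K) ^ 2 ≤ u ^ 2 := by
    have hlim := (tendsto_succ_pow_mul_pow (s := s ^ 2)
      ⟨pow_pos hs.1 2, pow_lt_one₀ hs.1.le hs.2 two_ne_zero⟩ D).const_mul c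
    rw [mul_zero] at hlim
    obtain ⟨K, hK⟩ := (hlim.eventually_le_const (pow_pos hu.1 2)).exists
    exact ⟨K, by rwa [mul_assoc, pow_right_comm]⟩
  refine ⟨Nat.find hexists, Nat.find_spec hexists, ?_⟩
  rcases hK : Nat.find hexists with - | K
  · calc u ^ 2 ≤ 1 := pow_le_one₀ hu.1.le hu.2
      _ ≤ max 1 (c / s ^ 2) := le_max_left _ _
      _ = _ := by simp
  · have hfail := not_le.1 (Nat.find_min hexists (K.lt_succ_self.trans_eq hK.symm))
    have := hs.1
    calc u ^ 2 ≤ c * (K + 1) ^ D * (s ^ K) ^ 2 := hfail.le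
      _ = c / s ^ 2 * (K + 1) ^ D * (s ^ (K + 1)) ^ 2 := by
          field_simp
          ring
      _ ≤ max 1 (c / s ^ 2) * ((K + 1 : ℕ) + 1) ^ D * (s ^ (K + 1)) ^ 2 := by
          gcongr
          exacts [le_max_right _ _, by simp]

theorem exists_succ_le_mul_one_sub_log (c : ℝ) : ∃ C ≥ 0, ∀ u ∈ Ioc (0 : ℝ) 1, ∀ K : ℕ,
    u ^ 2 ≤ c * (K + 1) ^ D * (s ^ K) ^ 2 → K + 1 ≤ C * (1 - Real.log u) := by
  obtain ⟨b, hb⟩ := ((tendsto_succ_pow_mul_pow hs D).const_mul c).bddAbove_range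
  set b' := max 1 b
  have hb' : 0 ≤ Real.log b' := Real.log_nonneg (le_max_left _ _)
  have hlogs : Real.log s < 0 := Real.log_neg hs.1 hs.2
  have hC : 0 ≤ (Real.log b' + 2) / -Real.log s := div_nonneg (by linarith) (by linarith)
  refine ⟨(Real.log b' + 2) / -Real.log s + 1, by linarith, fun u hu K hle ↦ ?_⟩
  have hL := one_le_one_sub_log hu
  have hsK : 0 < s ^ K := pow_pos hs.1 K
  have husK : u ^ 2 ≤ b' * s ^ K :=
    calc u ^ 2 ≤ c * ((K + 1) ^ D * s ^ K) * s ^ K := hle.trans_eq (by ring)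
      _ ≤ b' * s ^ K := by
          gcongr
          exact (hb ⟨K, rfl⟩).trans (le_max_right _ _)
  have hlog : 2 * Real.log u ≤ Real.log b' + K * Real.log s := by
    have := Real.log_le_log (pow_pos hu.1 2) husK
    rwa [Real.log_mul (lt_max_of_lt_left one_pos).ne' hsK.ne', Real.log_pow, Real.log_pow] at this
  have hK : (K : ℝ) ≤ (Real.log b' + 2) / -Real.log s * (1 - Real.log u) := by
    rw [div_mul_eq_mul_div, le_div_iff₀ (by linarith)]
    nlinarith
  linarith

end Level

theorem two_pow_mul_le_of_sq_le {W u c : ℝ} (hW : 0 < W) (hu : 0 < u) (hc : 0 ≤ c) {D K : ℕ}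
    (h : u ^ 2 ≤ c * (K + 1) ^ D * (((2 : ℝ) ^ (-1 / W)) ^ K) ^ 2) :
    2 ^ K * (K + 1) ^ D ≤ c ^ (W / 2) * (K + 1) ^ (D * (2 + W) / 2) * u ^ (-W) := by
  have hpow : ((((2 : ℝ) ^ (-1 / W)) ^ K) ^ 2) ^ (W / 2) = (2 ^ K)⁻¹ := by
    rw [← pow_mul, ← Real.rpow_mul_natCast zero_le_two, ← Real.rpow_mul zero_le_two,
      ← Real.rpow_natCast 2 K, ← Real.rpow_neg zero_le_two]
    congr 1
    push_cast
    field_simp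
  have huW : u ^ W ≤ c ^ (W / 2) * ((K : ℝ) + 1) ^ (D * W / 2) * (2 ^ K)⁻¹ :=
    calc u ^ W = (u ^ 2) ^ (W / 2) := by
          rw [← Real.rpow_natCast_mul hu.le]
          congr 1
          push_cast
          ring
      _ ≤ (c * (K + 1) ^ D * (((2 : ℝ) ^ (-1 / W)) ^ K) ^ 2) ^ (W / 2) := by gcongr
      _ = c ^ (W / 2) * ((K : ℝ) + 1) ^ (D * W / 2) * (2 ^ K)⁻¹ := by
          rw [Real.mul_rpow (by positivity) (by positivity),
            Real.mul_rpow hc (by positivity), hpow, ← Real.rpow_natCast_mul (by positivity)]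
          congr 3
          ring
  calc 2 ^ K * ((K : ℝ) + 1) ^ D = u ^ W * u ^ (-W) * (2 ^ K * (K + 1) ^ D) := by
        rw [← Real.rpow_add hu, add_neg_cancel, Real.rpow_zero, one_mul]
    _ ≤ c ^ (W / 2) * ((K : ℝ) + 1) ^ (D * W / 2) * (2 ^ K)⁻¹ * u ^ (-W) *
          (2 ^ K * (K + 1) ^ D) := by gcongr
    _ = c ^ (W / 2) * ((K : ℝ) + 1) ^ (D * (2 + W) / 2) * u ^ (-W) := by
        rw [show (D : ℝ) * (2 + W) / 2 = D * W / 2 + D by ring,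
          Real.rpow_add (by positivity), Real.rpow_natCast]
        field_simp

theorem exists_level {W : ℝ} (hW : 0 < W) (D : ℕ) (c : ℝ) :
    ∃ C ≥ 0, ∀ u ∈ Ioc (0 : ℝ) 1, ∃ K : ℕ,
      c * (K + 1) ^ D * (((2 : ℝ) ^ (-1 / W)) ^ K) ^ 2 ≤ u ^ 2 ∧
      2 ^ K * (K + 1) ^ D ≤ C * (u ^ (-W) * (1 - Real.log u) ^ (D * (2 + W) / 2)) := by
  have hs : (2 : ℝ) ^ (-1 / W) ∈ Ioo 0 1 := ⟨by positivity,
    Real.rpow_lt_one_of_one_lt_of_neg one_lt_two (div_neg_of_neg_of_pos (by norm_num) hW)⟩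
  set c' := max 1 (c / ((2 : ℝ) ^ (-1 / W)) ^ 2)
  have hc' : 0 ≤ c' := zero_le_one.trans (le_max_left _ _)
  obtain ⟨C, hC, hlevel⟩ := exists_succ_le_mul_one_sub_log hs D c'
  refine ⟨c' ^ (W / 2) * C ^ (D * (2 + W) / 2), by positivity, fun u hu ↦ ?_⟩
  obtain ⟨K, hKu, huK⟩ := exists_nearly_optimal_level hs D hu
  have hL := one_le_one_sub_log hu
  have hu0 := hu.1
  refine ⟨K, hKu, ?_⟩
  calc 2 ^ K * ((K : ℝ) + 1) ^ D
      ≤ c' ^ (W / 2) * ((K : ℝ) + 1) ^ (D * (2 + W) / 2) * u ^ (-W) :=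
        two_pow_mul_le_of_sq_le hW hu0 hc' huK
    _ ≤ c' ^ (W / 2) * (C * (1 - Real.log u)) ^ (D * (2 + W) / 2) * u ^ (-W) := by
        gcongr
        exact hlevel u hu K huK
    _ = _ := by
        rw [Real.mul_rpow hC (by linarith)]
        ring

theorem exists_hasApproximationRate_tensorPower (D q : ℕ) (γ : ℝ) {W : ℝ} (hW : 0 < W) :
    ∃ C ≥ 0, ∀ {m r : ℕ} {Ψ : Matrix (Fin m) (Fin r) ℝ}, (∀ j, ‖column Ψ j‖ ≤ 1) →
      (∃ V, IsNestedApproximation V Ψ q γ W) →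
      HasApproximationRate (columnSet (tensorPower (D + 1) Ψ)) C W (D * (2 + W) / 2) := by
  set s : ℝ := 2 ^ (-1 / W)
  have hs1 : s ≤ 1 := Real.rpow_le_one_of_one_le_of_nonpos one_le_two
    (div_nonpos_of_nonpos_of_nonneg (by norm_num) hW.le)
  obtain ⟨C, hC, hlevel⟩ :=
    exists_level hW D ((2 * (max 1 γ / s) ^ 2) ^ (D + 1))
  refine ⟨q ^ (D + 1) * C, by positivity, ?_⟩
  rintro m r Ψ hΨ ⟨V, hV⟩ u hu
  obtain ⟨K, hKu, hK⟩ := hlevel u hu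
  refine ⟨hyperbolicCross V D K, inferInstance, ?_, ?_⟩
  · calc (finrank ℝ (hyperbolicCross V D K) : ℝ) ≤ q ^ (D + 1) * 2 ^ K * (K + 1) ^ D := by
          exact_mod_cast finrank_hyperbolicCross_le hV.finrank_le D K
      _ ≤ q ^ (D + 1) * C * (u ^ (-W) * (1 - Real.log u) ^ (D * (2 + W) / 2)) := by
          rw [mul_assoc, mul_assoc]
          gcongr
  · rintro _ ⟨j, rfl⟩
    obtain ⟨g, hg, hle⟩ := exists_mem_hyperbolicCross_norm_sub_sq_le
      (monotone_nat_of_le_succ hV.nested) hΨ (le_max_left 1 γ) (by positivity) hs1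
      (hV.norm_sub_starProjection_le hΨ) D K j
    exact (norm_orthogonal_starProjection_le _ hg).trans
      (le_of_sq_le_sq (hle.trans hKu) hu.1.le)

theorem one_le_log_one_div {ε : ℝ} (hε : ε ∈ Ioc 0 (Real.exp (-1))) : 1 ≤ Real.log (1 / ε) := by
  rw [one_div, Real.log_inv, le_neg]
  exact (Real.log_le_iff_le_exp hε.1).2 hε.2

theorem one_sub_log_rpow_le {ε b : ℝ} (hε : ε ∈ Ioc 0 (Real.exp (-1))) (hb : 0 ≤ b) :
    (1 - Real.log ε) ^ b ≤ 2 ^ b * Real.log (1 / ε) ^ b := by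
  have hL := one_le_log_one_div hε
  have hsub : 1 - Real.log ε = 1 + Real.log (1 / ε) := by
    rw [one_div, Real.log_inv, sub_eq_add_neg]
  rw [← Real.mul_rpow zero_le_two (zero_le_one.trans hL), hsub]
  exact Real.rpow_le_rpow (by linarith) (by linarith) hb

theorem Ioc_exp_neg_one_subset : Ioc 0 (Real.exp (-1)) ⊆ Ioc 0 1 :=
  Ioc_subset_Ioc_right (Real.exp_le_one_iff.2 (by norm_num))

theorem entropyRate_le {W b ε : ℝ} (hW : 0 < W) (hb : 0 ≤ b) (hε : ε ∈ Ioc 0 (Real.exp (-1))) :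
    entropyRate W (b * (2 + W) / 2) ε ≤ 2 ^ (b + W / (2 + W)) * (ε ^ (-(2 * W / (2 + W))) *
      Real.log (1 / ε) ^ b * Real.log (1 / ε) ^ (W / (2 + W))) := by
  have hε0 := hε.1
  have hexponent : (2 * (b * (2 + W) / 2) + W) / (2 + W) = b + W / (2 + W) := by field_simp
  rw [entropyRate, hexponent, mul_assoc, ← Real.rpow_add (by linarith [one_le_log_one_div hε]),
    mul_left_comm]
  gcongr
  exact one_sub_log_rpow_le hε (by positivity)

section Matrix

variable {ι κ : Type*} [Fintype ι] {X : Matrix ι κ ℝ}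

theorem epsApproximation_le_finrank {ε : ℝ} {𝒱 : Submodule ℝ (EuclideanSpace ℝ ι)}
    (hpos : 0 < finrank ℝ 𝒱) (h : approximationNumber 𝒱 X ≤ ε) :
    epsApproximation ε X ≤ finrank ℝ 𝒱 :=
  Nat.sInf_le ⟨hpos, 𝒱, rfl, h⟩

theorem epsApproximation_of_isEmpty [IsEmpty ι] (ε : ℝ) : epsApproximation ε X = 0 := by
  refine Nat.sInf_eq_zero.2 (.inr (eq_empty_of_forall_notMem ?_))
  rintro N ⟨hN, 𝒱, rfl, -⟩
  rw [finrank_zero_of_subsingleton] at hN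
  exact absurd hN (by norm_num)

theorem epsApproximation_le_max {ε : ℝ} (hε : 0 ≤ ε) (𝒱 : Submodule ℝ (EuclideanSpace ℝ ι))
    (h : ∀ x ∈ columnSet X, ‖𝒱ᗮ.starProjection x‖ ≤ ε) :
    epsApproximation ε X ≤ max 1 (finrank ℝ 𝒱) := by
  rcases (finrank ℝ 𝒱).eq_zero_or_pos with hzero | hpos
  · refine le_max_of_le_left ?_
    rcases isEmpty_or_nonempty ι with hι | hι
    · simp only [epsApproximation_of_isEmpty, zero_le]
    -- The definition only admits subspaces of positive dimension, so `⊥` is replaced by a line.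
    obtain ⟨v, hv⟩ := exists_ne (0 : EuclideanSpace ℝ ι)
    have hcolumn (j : κ) : ‖column X j‖ ≤ ε := by
      simpa [Submodule.finrank_eq_zero.1 hzero, Submodule.starProjection_top] using h _ ⟨j, rfl⟩
    rw [← finrank_span_singleton (K := ℝ) hv]
    exact epsApproximation_le_finrank (by rw [finrank_span_singleton hv]; exact one_pos)
      (Real.iSup_le (fun j ↦ (Submodule.norm_starProjection_apply_le _ _).trans (hcolumn j)) hε)
  · exact le_max_of_le_right
      (epsApproximation_le_finrank hpos (Real.iSup_le (fun j ↦ h _ ⟨j, rfl⟩) hε))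

theorem sum_smul_mem_of_absConvex [Fintype κ] {E : Type*} [AddCommGroup E] [Module ℝ E]
    {s : Set E} (hs : AbsConvex ℝ s) (hs0 : s.Nonempty) {z : κ → E} (hz : ∀ j, z j ∈ s)
    {β : κ → ℝ} (hβ : ∑ j, |β j| ≤ 1) : ∑ j, β j • z j ∈ s := by
  have hzero : (0 : E) ∈ s := hs.1.zero_mem hs0
  have hsign (j : κ) : (SignType.sign (β j) : ℝ) • z j ∈ s := by
    rcases lt_trichotomy (β j) 0 with h | h | h
    · simpa [h] using hs.1.neg_mem_iff.2 (hz j)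
    · simpa [h] using hzero
    · simpa [h] using hz j
  have := hs.2.sum_mem (t := Finset.univ)
    (w := fun o : Option κ ↦ o.elim (1 - ∑ j, |β j|) fun j ↦ |β j|)
    (z := fun o ↦ o.elim 0 fun j ↦ (SignType.sign (β j) : ℝ) • z j)
    (by rintro (_ | j) -; exacts [sub_nonneg.2 hβ, abs_nonneg _])
    (by simp [Fintype.sum_option]) (by rintro (_ | j) -; exacts [hzero, hsign j])
  simpa [Fintype.sum_option, ← mul_smul, abs_mul_sign] using this

theorem absconv_subset_absConvexHull [Fintype κ] [Nonempty κ] :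
    absconv X ⊆ absConvexHull ℝ (columnSet X) := by
  rintro _ ⟨β, hβ, rfl⟩
  have hsum : WithLp.toLp 2 (X.mulVec β) = ∑ j, β j • column X j := by
    ext i
    simp [column, Matrix.mulVec, dotProduct, mul_comm]
  rw [hsum]
  exact sum_smul_mem_of_absConvex absConvex_absConvexHull
    (absConvexHull_nonempty.2 (range_nonempty _)) (fun j ↦ subset_absConvexHull ⟨j, rfl⟩) hβ

theorem entropy_absconv_le_max [Fintype κ] {ε : ℝ} (hε : 0 ≤ ε) :
    entropy ε (absconv X) ≤ max 0 (entropy ε (absConvexHull ℝ (columnSet X))) := by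
  rcases isEmpty_or_nonempty κ with hκ | hκ
  · have hsub : absconv X ⊆ closedBall 0 ε := by
      rintro _ ⟨β, -, rfl⟩
      simpa [Matrix.mulVec_eq_sum] using hε
    exact le_max_of_le_left (ENNReal.log_le_zero_iff.2
      ((coveringNumber_mono hsub).trans (coveringNumber_closedBall 0 ε)))
  · exact le_max_of_le_right
      (ENNReal.log_monotone (coveringNumber_mono absconv_subset_absConvexHull))

theorem HasApproximationRate.epsApproximation_le {C W e ε : ℝ} (hW : 0 ≤ W) (he : 0 ≤ e)
    (h : HasApproximationRate (columnSet X) C W e) (hε : ε ∈ Ioc 0 (Real.exp (-1))) :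
    epsApproximation ε X ≤ max 1 (C * 2 ^ e) * (ε ^ (-W) * Real.log (1 / ε) ^ e) := by
  have hε1 := Ioc_exp_neg_one_subset hε
  have hC := h.nonneg
  have hε0 := hε.1
  obtain ⟨𝒱, _, hdim, happrox⟩ := h ε hε1
  have hone : 1 ≤ ε ^ (-W) * Real.log (1 / ε) ^ e :=
    one_le_mul_of_one_le_of_one_le
      (Real.one_le_rpow_of_pos_of_le_one_of_nonpos hε.1 hε1.2 (neg_nonpos.2 hW))
      (Real.one_le_rpow (one_le_log_one_div hε) he)
  have hnonneg := zero_le_one.trans hone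
  have hfinrank : finrank ℝ 𝒱 ≤ C * 2 ^ e * (ε ^ (-W) * Real.log (1 / ε) ^ e) :=
    calc (finrank ℝ 𝒱 : ℝ) ≤ C * (ε ^ (-W) * (1 - Real.log ε) ^ e) := hdim
      _ ≤ C * (ε ^ (-W) * (2 ^ e * Real.log (1 / ε) ^ e)) := by
          gcongr
          exact one_sub_log_rpow_le hε he
      _ = C * 2 ^ e * (ε ^ (-W) * Real.log (1 / ε) ^ e) := by ring
  calc (epsApproximation ε X : ℝ) ≤ max 1 (finrank ℝ 𝒱 : ℝ) := by
        exact_mod_cast epsApproximation_le_max hε.1.le 𝒱 happrox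
    _ ≤ max 1 (C * 2 ^ e) * (ε ^ (-W) * Real.log (1 / ε) ^ e) := by
        rw [max_mul_of_nonneg _ _ hnonneg, one_mul]
        exact max_le_max hone hfinrank

end Matrix

theorem exists_entropy_absconv_le {W b A : ℝ} (hW : 0 < W) (hb : 0 ≤ b) (C V : ℝ) (hA : 0 < A) :
    ∃ C' ≥ 0, ∀ {ι κ : Type*} [Fintype ι] [Fintype κ] {X : Matrix ι κ ℝ},
      columnSet X ⊆ closedBall 0 1 → HasApproximationRate (columnSet X) C W (b * (2 + W) / 2) →
      HasCoveringRate (columnSet X) A V → ∀ ε ∈ Ioc 0 (Real.exp (-1)),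
        entropy ε (absconv X) ≤ (C' * (ε ^ (-(2 * W / (2 + W))) * Real.log (1 / ε) ^ b *
          Real.log (1 / ε) ^ (W / (2 + W))) : ℝ) := by
  obtain ⟨C', hC', hentropy⟩ :=
    exists_entropy_absConvexHull_le hW (e := b * (2 + W) / 2) (by positivity) C V hA
  refine ⟨C' * 2 ^ (b + W / (2 + W)), by positivity, fun hX happrox hcov ε hε ↦ ?_⟩
  have hε1 := Ioc_exp_neg_one_subset hε
  have hrate : (0 : EReal) ≤ (C' * entropyRate W (b * (2 + W) / 2) ε : ℝ) :=
    EReal.coe_nonneg.2 (mul_nonneg hC' (entropyRate_nonneg hε1))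
  refine (entropy_absconv_le_max hε.1.le).trans
    ((max_le hrate (hentropy hX happrox hcov ε hε1)).trans (EReal.coe_le_coe_iff.2 ?_))
  rw [mul_assoc C']
  exact mul_le_mul_of_nonneg_left (entropyRate_le hW hb hε) hC'

end TensorEntropy

end

theorem mainTheorem3 (d q : ℕ) (hd : 1 ≤ d) (hq : 1 ≤ q) (γ W : ℝ) (hγ : 0 < γ) (hW : 0 < W) :
    (∃ C ε₀ : ℝ, 0 < C ∧ 0 < ε₀ ∧ ε₀ < 1 ∧
      ∀ (m r : ℕ) (Ψ : Matrix (Fin m) (Fin r) ℝ),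
        (∀ j, ‖TensorEntropy.column Ψ j‖ ≤ 1) →
        (∃ 𝒱, TensorEntropy.IsNestedApproximation 𝒱 Ψ q γ W) →
        ∀ ε : ℝ, 0 < ε → ε ≤ ε₀ →
          (TensorEntropy.epsApproximation ε (TensorEntropy.tensorPower d Ψ) : ℝ) ≤
            C * (ε ^ (-W) * Real.log (1 / ε) ^ (((d : ℝ) - 1) * (2 + W) / 2))) ∧
    (∀ V A ε₁ : ℝ, 0 < A → 0 < ε₁ →
      ∃ C ε₀ : ℝ, 0 < C ∧ 0 < ε₀ ∧ ε₀ < 1 ∧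
        ∀ (m r : ℕ) (Ψ : Matrix (Fin m) (Fin r) ℝ),
          (∀ j, ‖TensorEntropy.column Ψ j‖ ≤ 1) →
          (∃ 𝒱, TensorEntropy.IsNestedApproximation 𝒱 Ψ q γ W) →
          (∀ ε : ℝ, 0 < ε → ε ≤ ε₁ →
            TensorEntropy.coveringNumber ε (TensorEntropy.columnSet Ψ) ≤
              ENNReal.ofReal (A * ε ^ (-V))) →
          ∀ ε : ℝ, 0 < ε → ε ≤ ε₀ →
            TensorEntropy.coveringNumber ε
                (TensorEntropy.columnSet (TensorEntropy.tensorPower d Ψ)) ≤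
              ENNReal.ofReal (C * ε ^ (-((d : ℝ) * V))) ∧
            TensorEntropy.entropy ε
                (TensorEntropy.absconv (TensorEntropy.tensorPower d Ψ)) ≤
              ((C * (ε ^ (-(2 * W / (2 + W))) * Real.log (1 / ε) ^ ((d : ℝ) - 1) *
                Real.log (1 / ε) ^ (W / (2 + W))) : ℝ) : EReal)) := by
  obtain ⟨D, rfl⟩ : ∃ D, d = D + 1 := ⟨d - 1, by omega⟩
  have hD : ((D + 1 : ℕ) : ℝ) - 1 = D := by push_cast; ring
  rw [hD]
  have hexp : Real.exp (-1) < 1 := Real.exp_lt_one_iff.2 (by norm_num)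
  obtain ⟨C, -, happrox⟩ := TensorEntropy.exists_hasApproximationRate_tensorPower D q γ hW
  refine ⟨⟨max 1 (C * 2 ^ (D * (2 + W) / 2)), Real.exp (-1), by positivity, Real.exp_pos _, hexp,
    fun m r Ψ hΨ h𝒱 ε hε hε₀ ↦
      (happrox hΨ h𝒱).epsApproximation_le hW.le (by positivity) ⟨hε, hε₀⟩⟩,
    fun V A ε₁ hA hε₁ ↦ ?_⟩
  obtain ⟨A', hA', hcovering⟩ :=
    TensorEntropy.exists_hasCoveringRate_tensorPower (D + 1) V hA hε₁
  obtain ⟨C', hC', hentropy⟩ :=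
    TensorEntropy.exists_entropy_absconv_le hW D.cast_nonneg C ((D + 1 : ℕ) * V) hA'
  refine ⟨A' + C', Real.exp (-1), by positivity, Real.exp_pos _, hexp,
    fun m r Ψ hΨ h𝒱 hcov ε hε hε₀ ↦ ?_⟩
  have hlog := TensorEntropy.one_le_log_one_div ⟨hε, hε₀⟩
  refine ⟨(hcovering hΨ hcov ε ⟨hε, hε₀.trans hexp.le⟩).trans (ENNReal.ofReal_le_ofReal ?_),
    (hentropy (TensorEntropy.columnSet_tensorPower_subset_closedBall hΨ _) (happrox hΨ h𝒱)
      (hcovering hΨ hcov) ε ⟨hε, hε₀⟩).trans (EReal.coe_le_coe_iff.2 ?_)⟩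
  all_goals gcongr; linarith
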